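/- **Setting (protocol BB84-INFO-$z$).** Fix integers $n,n_z,n_x>0$, $r\ge 0$ and $m\ge 1$, put $N=n+n_z+n_x$, and fix thresholds $p_{a,z},p_{a,x}>0$. Let $P_C$ be an $r\times n$ and $P_K$ an $m\times n$ matrix over $\mathbf F_2$, with rows $v_1,\dots,v_r$ and $v_{r+1},\dots,v_{r+m}$ respectively. Write $|\cdot|$ for Hamming weight and $d_H$ for Hamming distance, $V_{r'}=\operatorname{Span}\{v_1,\dots,v_{r'}\}$, and $$d_{r,m}=\min_{r\le r'<r+m} d_H(v_{r'+1},V_{r'}).$$ Let $|0^0\rangle,|1^0\rangle$ be the computational ($z$) basis of a qubit and $|0^1\rangle,|1^1\rangle=\frac{|0^0\rangle\pm|1^0\rangle}{\sqrt2}$ the $x$ basis. Alice chooses, uniformly and independently, a string $\mathbf i\in\mathbf F_2^N$ and a partition $\mathcal P=(\mathbf s,\mathbf z,\mathbf b)$ of the $N$ positions, that is, $\mathbf s,\mathbf z,\mathbf b\in\mathbf F_2^N$ with $|\mathbf s|=n$, $|\mathbf z|=n_z$, $|\mathbf b|=n_x$, $|\mathbf s+\mathbf z+\mathbf b|=N$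 (INFO, TEST-Z and TEST-X positions), and sends the qubits $|i_j^{b_j}\rangle$. Eve performs a collective attack, chosen independently of $\mathbf i$ and $\mathcal P$: to the $j$-th qubit she attaches a finite-dimensional probe in a pure state, applies a unitary $U_j$ to probe and qubit, keeps the probe, and forwards the qubit. Bob measures the $j$-th qubit in the basis $b_j$, obtaining $\mathbf i^B\in\mathbf F_2^N$. Let $P(\mathbf i,\mathbf i^B,\mathcal P)$ be the joint probability, and let $\rho^{E}_{\mathbf i,\mathbf i^B,\mathcal P}$ be the resulting normalized state of Eve's probes given $\mathbf i,\mathbf i^B,\mathcal P$. Put $\mathbf c=\mathbf i+\mathbf i^B$, write $\mathbf a_{\mathbf s},\mathbf a_{\mathbf z},\mathbf a_{\mathbf b}$ for the substrings of $\mathbf a$ at the INFO, TEST-Z and TEST-X positions, and let $\mathbf T=1$ if $|\mathbf c_{\mathbf z}|/n_z\le p_{a,z}$ and $|\mathbf c_{\mathbf b}|/n_x\le p_{a,x}$, and $\mathbf T=0$ otherwise (the protocol aborts). Put $\mathbf x=\mathbf i_{\mathbf s}$, $\mathbf x^B=\mathbf i^B_{\mathbf s}$, $\boldsymbol\xi=\mathbf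 xP_C^{T}$ (the published syndrome) and $\mathbf k=\mathbf xP_K^{T}$ (Alice's final key); let $\mathbf k'=\mathbf{y}P_K^{T}$ be Bob's final key, where $\mathbf y$ is obtained from $\mathbf x^B$ and $\boldsymbol\xi$ by any fixed error correction map. Let $\mathbf t=(\mathbf i_{\mathbf z},\mathbf i_{\mathbf b},\mathbf i^B_{\mathbf z},\mathbf i^B_{\mathbf b})$ be the published test bits. Define $$\rho_{ABE}=\sum_{\mathbf i,\mathbf i^B,\mathcal P\,\mid\,\mathbf T=1}P(\mathbf i,\mathbf i^B,\mathcal P)\;|\mathbf k\rangle\langle\mathbf k|_A\otimes|\mathbf k'\rangle\langle\mathbf k'|_B\otimes\rho^{E}_{\mathbf i,\mathbf i^B,\mathcal P}\otimes|\mathbf t,\mathcal P,\boldsymbol\xi\rangle\langle\mathbf t,\mathcal P,\boldsymbol\xi|_C ,$$ let $\rho'_{ABE}$ be the same sum with $|\mathbf k\rangle\langle\mathbf k|_B$ in place of $|\mathbf k'\rangle\langle\mathbf k'|_B$, and let $$\rho_U=\frac1{2^m}\sum_{\mathbf k\in\mathbf F_2^m}|\mathbf k\rangle\langle\mathbf k|_A\otimes|\mathbf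 k\rangle\langle\mathbf k|_B,\qquad \rho_E=\operatorname{tr}_{AB}(\rho_{ABE}),$$ where Eve's system consists of her probes and of the classical register $C$. **Proposition.** Let $\delta,R,\epsilon_{\mathrm{sec}}>0$. Suppose that $v_1,\dots,v_{r+m}$ are linearly independent, that $\delta<\frac{d_{r,m}}{n}$ and $\frac mn\le R$, and that $p_{a,x}+\epsilon_{\mathrm{sec}}\le\frac\delta2$. Then, for every collective attack of Eve, $$\frac12\operatorname{tr}\bigl|\rho'_{ABE}-\rho_U\otimes\rho_E\bigr|\le 2R\,n\,e^{-\left(\frac{n_x}{n+n_x}\right)^2 n\,\epsilon_{\mathrm{sec}}^2}.$$ (In particular, the bound holds, with the same $\delta$ and $R$, for every member of any family of such vectors given for infinitely many $n$.) -/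

import Mathlib

open scoped Kronecker

noncomputable section

namespace BB84InfoZ

/-! ### Bits, bit strings and codes -/

/-- The field with two elements. -/
abbrev Bit : Type := ZMod 2

/-- Bit strings of length `t`, as vectors over the field with two elements. Their weight is
`hammingNorm`, and the Hamming distance of two strings is `hammingDist`. -/
abbrev BitString (t : ℕ) : Type := Fin t → Bit

/-- The Hamming distance from the vector `w` to the subspace `V`. -/
def distToSubspace {n : ℕ} (w : BitString n) (V : Submodule Bit (BitString n)) : ℕ :=
  sInf {d : ℕ | ∃ u ∈ V, d = hammingDist w u}

/-- For vectors `v_1, …, v_{r+m}`, the minimum over `r ≤ r' < r + m` of the Hamming distance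
from `v_{r'+1}` to the span of `v_1, …, v_{r'}`. Indices in `Fin` start from `0`, so that
`v (Fin.natAdd r j)` with `j : Fin m` is the vector `v_{r'+1}` with `r' = r + j`. For `m = 0`
the minimum is over the empty set, and the value is `0`. -/
def minDist {n r m : ℕ} (v : Fin (r + m) → BitString n) : ℕ :=
  ⨅ j : Fin m, distToSubspace (v (Fin.natAdd r j))
    (Submodule.span Bit (v '' {l | l < Fin.natAdd r j}))

/-! ### The public parameters of the protocol -/

/-- The public parameters: the numbers of INFO, TEST-Z and TEST-X bits, the error thresholds,
the parity check matrix, the privacy amplification matrix, and Bob's error correction, which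
turns his INFO string and Alice's syndrome into a corrected INFO string. -/
structure Params where
  /-- number of INFO bits -/
  n : ℕ
  /-- number of TEST-Z bits -/
  nz : ℕ
  /-- number of TEST-X bits -/
  nx : ℕ
  /-- length of the syndrome -/
  r : ℕ
  /-- length of the final key -/
  m : ℕ
  /-- error threshold on the TEST-Z bits -/
  paz : ℝ
  /-- error threshold on the TEST-X bits -/
  pax : ℝ
  /-- parity check matrix of the error-correcting code -/
  PC : Matrix (Fin r) (Fin n) Bit
  /-- privacy amplification matrix -/
  PK : Matrix (Fin m) (Fin n) Bit
  /-- error correction: Bob's INFO string and the syndrome give the corrected string -/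
  correct : BitString n → BitString r → BitString n

namespace Params

variable (Q : Params)

/-- The total number `N` of qubits. -/
abbrev N : ℕ := Q.n + Q.nz + Q.nx

/-- The vectors `v_1, …, v_{r+m}`: the rows of `PC` followed by the rows of `PK`. -/
def rows : Fin (Q.r + Q.m) → BitString Q.n := Fin.append Q.PC.row Q.PK.row

/-- The final keys. -/
abbrev Key : Type := BitString Q.m

/-- The partitions `(s, z, b)` of the `N` bits: three `N`-bit strings of weights `n`, `nz`, `nx`
whose sum has weight `N`. -/
abbrev Partition : Type :=
  {P : BitString Q.N × BitString Q.N × BitString Q.N //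
    hammingNorm P.1 = Q.n ∧ hammingNorm P.2.1 = Q.nz ∧ hammingNorm P.2.2 = Q.nx ∧
    hammingNorm (P.1 + P.2.1 + P.2.2) = Q.N}

end Params

/-- The substring of `i` formed by the positions where `s` is `1`, in increasing order. -/
def substring {N k : ℕ} (s : BitString N) (hs : hammingNorm s = k) (i : BitString N) :
    BitString k :=
  fun l => i (Finset.orderEmbOfFin (Finset.univ.filter fun j => s j ≠ 0) hs l)

namespace Params

variable {Q : Params}

/-- The substring of the INFO bits. -/
def info (P : Q.Partition) (i : BitString Q.N) : BitString Q.n :=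
  substring P.1.1 P.2.1 i

/-- The substring of the TEST-Z bits. -/
def testZ (P : Q.Partition) (i : BitString Q.N) : BitString Q.nz :=
  substring P.1.2.1 P.2.2.1 i

/-- The substring of the TEST-X bits. -/
def testX (P : Q.Partition) (i : BitString Q.N) : BitString Q.nx :=
  substring P.1.2.2 P.2.2.2.1 i

/-- The string `b` of bases: the `j`-th qubit is sent and measured in the `x` basis if and only
if `b_j = 1`. -/
def bases (P : Q.Partition) : BitString Q.N := P.1.2.2

/-- The test is passed: the error rates on the TEST-Z bits and on the TEST-X bits are both below
their thresholds, if Alice sends `i` and Bob measures `iB`. -/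
def TestPassed (P : Q.Partition) (i iB : BitString Q.N) : Prop :=
  (hammingNorm (testZ P (i + iB)) : ℝ) / Q.nz ≤ Q.paz ∧
  (hammingNorm (testX P (i + iB)) : ℝ) / Q.nx ≤ Q.pax

/-- The syndrome of an INFO string. -/
def syndrome (Q : Params) (x : BitString Q.n) : BitString Q.r := Matrix.vecMul x Q.PC.transpose

/-- The final key computed from an INFO string. -/
def key (Q : Params) (x : BitString Q.n) : Q.Key := Matrix.vecMul x Q.PK.transpose

/-- The information published on the classical channel: the TEST-Z and TEST-X bits of Alice, the
TEST-Z and TEST-X bits of Bob, the partition, and the syndrome. -/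
abbrev Public (Q : Params) : Type :=
  BitString Q.nz × BitString Q.nx × BitString Q.nz × BitString Q.nx ×
    Q.Partition × BitString Q.r

/-- The published information, if Alice sends `i`, Bob measures `iB`, and `P` is the partition. -/
def published (P : Q.Partition) (i iB : BitString Q.N) : Q.Public :=
  (testZ P i, testX P i, testZ P iB, testX P iB, P, Q.syndrome (info P i))

/-- Alice's final key. -/
def aliceKey (P : Q.Partition) (i : BitString Q.N) : Q.Key := Q.key (info P i)

/-- Bob's final key, computed from his corrected INFO string. -/
def bobKey (P : Q.Partition) (i iB : BitString Q.N) : Q.Key :=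
  Q.key (Q.correct (info P iB) (Q.syndrome (info P i)))

end Params

/-! ### Qubits and collective attacks -/

/-- Coordinates in the computational basis of the qubit state that encodes the bit `i` in the
`z` basis (`b = 0`) or in the `x` basis (`b = 1`). -/
def ket (b i : Bit) : Bit → ℂ :=
  if b = 0 then fun t => if t = i then 1 else 0
  else fun t => if i = 1 ∧ t = 1 then -(1 / (Real.sqrt 2 : ℂ)) else 1 / (Real.sqrt 2 : ℂ)

/-- A collective attack on `N` qubits: to the `j`-th qubit Eve attaches a probe of finite
dimension `dim j` in the pure state `init j`, and applies the unitary `U j` to the compound system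
of the probe and the qubit. -/
structure CollectiveAttack (N : ℕ) where
  dim : Fin N → ℕ
  init : ∀ j, EuclideanSpace ℂ (Fin (dim j))
  init_unit : ∀ j, ‖init j‖ = 1
  U : ∀ j, Matrix.unitaryGroup (Fin (dim j) × Bit) ℂ

namespace CollectiveAttack

variable {N : ℕ} (A : CollectiveAttack N)

/-- Basis labels for the compound system of Eve's `N` probes. -/
abbrev Probes : Type := ∀ j, Fin (A.dim j)

/-- The non-normalized state of the `j`-th probe if the `j`-th qubit is sent in the basis `b` with
the bit `i`, and Bob, measuring in the same basis, obtains the bit `i'`: the vector `E^b_{i i'}` in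
`U (init ⊗ |i⟩) = ∑ i', E^b_{i i'} ⊗ |i'⟩`. -/
def branch (j : Fin N) (b i i' : Bit) : Fin (A.dim j) → ℂ := fun e =>
  ∑ t : Bit, star (ket b i' t) *
    ((A.U j : Matrix (Fin (A.dim j) × Bit) (Fin (A.dim j) × Bit) ℂ).mulVec
      (fun p => A.init j p.1 * ket b i p.2)) (e, t)

/-- The probability that Bob measures `iB` if Alice sends `i` in the bases `b`. -/
def outcomeProb (b i iB : BitString N) : ℝ :=
  ∏ j, ∑ e, ‖A.branch j (b j) (i j) (iB j) e‖ ^ 2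

/-- The non-normalized joint state vector of Eve's probes if Alice sends `i` in the bases `b` and
Bob measures `iB`. -/
def probeVector (b i iB : BitString N) : A.Probes → ℂ :=
  fun e => ∏ j, A.branch j (b j) (i j) (iB j) (e j)

/-- Eve's normalized quantum state (density matrix of her probes) if Alice sends `i` in the
bases `b` and Bob measures `iB`. If this event has probability zero, the value is the zero
matrix. -/
def eveState (b i iB : BitString N) : Matrix A.Probes A.Probes ℂ :=
  ((A.outcomeProb b i iB)⁻¹ : ℂ) •
    Matrix.vecMulVec (A.probeVector b i iB) (star (A.probeVector b i iB))

end CollectiveAttack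

/-! ### Operators -/

open Classical in
/-- The projector onto the basis state with label `a`. -/
def proj {α : Type*} (a : α) : Matrix α α ℂ := Matrix.single a a 1

/-- The partial trace over the first subsystem. -/
def traceFst {α β : Type*} [Fintype α] (M : Matrix (α × β) (α × β) ℂ) : Matrix β β ℂ :=
  Matrix.of fun x y => ∑ a, M (a, x) (a, y)

open Classical in
open scoped MatrixOrder in
/-- The trace norm `tr |M|`, where `|M|` is the positive square root of `M† M`. -/
def traceNorm {α : Type*} [Fintype α] (M : Matrix α α ℂ) : ℝ :=
  (CFC.abs M).trace.re

/-! ### The final states of the protocol -/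

section FinalStates

variable {Q : Params} (A : CollectiveAttack Q.N)

/-- The probability that Alice sends `i`, Bob measures `iB`, and the partition is `P`: the
partition and the string `i` are uniformly random and independent. -/
def jointProb (i iB : BitString Q.N) (P : Q.Partition) : ℝ :=
  1 / (Fintype.card Q.Partition : ℝ) * (1 / 2 ^ Q.N) * A.outcomeProb (Params.bases P) i iB

/-- Labels for the compound system of Alice, Bob and Eve: Alice's and Bob's final keys, and Eve's
system, which consists of her probes and of the published information. -/
abbrev ABE : Type := (Q.Key × Q.Key) × (A.Probes × Q.Public)

open Classical in
/-- The (non-normalized) final state of Alice, Bob and Eve, if Bob holds the key `kB P i iB`. The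
sum is over the events in which the test is passed. -/
def finalStateWith (kB : Q.Partition → BitString Q.N → BitString Q.N → Q.Key) :
    Matrix (ABE A) (ABE A) ℂ :=
  ∑ i : BitString Q.N, ∑ iB : BitString Q.N, ∑ P : Q.Partition,
    if Params.TestPassed P i iB then
      (jointProb A i iB P : ℂ) •
        ((proj (Params.aliceKey P i) ⊗ₖ proj (kB P i iB)) ⊗ₖ
          (A.eveState (Params.bases P) i iB ⊗ₖ proj (Params.published P i iB)))
    else 0

/-- The final state `ρ_ABE` of the protocol: Bob holds the key that he has computed. -/
def rhoABE : Matrix (ABE A) (ABE A) ℂ :=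
  finalStateWith A fun P i iB => Params.bobKey P i iB

/-- The intermediate state `ρ'_ABE`: Bob holds Alice's final key. -/
def rhoABEprime : Matrix (ABE A) (ABE A) ℂ :=
  finalStateWith A fun P i _ => Params.aliceKey P i

/-- Eve's state `ρ_E`: the partial trace of `ρ_ABE` over the systems of Alice and Bob. -/
def rhoE : Matrix (A.Probes × Q.Public) (A.Probes × Q.Public) ℂ := traceFst (rhoABE A)

/-- The ideal state `ρ_U`: a uniformly random key, the same for Alice and Bob. -/
def rhoU (Q : Params) : Matrix (Q.Key × Q.Key) (Q.Key × Q.Key) ℂ :=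
  (1 / 2 ^ Q.m : ℂ) • ∑ k : Q.Key, proj k ⊗ₖ proj k

end FinalStates

end BB84InfoZ

end

noncomputable section

namespace BB84InfoZ

/-! ### Hoeffding's bound for sampling without replacement -/

section Sampling

/-! The trace norm of the Hermitian difference `D` is `tr (D W)` with `W` the sign of `D`. Keys and
published data are classical, so only diagonal blocks `g k` of `W` matter, and the trace becomes a
sum of forms of `g k` minus its average over keys, evaluated on Eve's vectors
(`trace_difference_mul`). Telescoping over the key bits replaces this by `m` operators `hybridDiff`.
As a function of the INFO string `x`, each picks up the sign `(-1)^(x₀ ⬝ v)` when `x` is shifted by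
an `x₀` orthogonal to the span `V` of the rows preceding its own row `v` (`hybridDiff_key_add`).

Expanding the `z` basis in the `x` basis exhibits Eve's vectors as a double Fourier transform of the
vectors `F s s'` she would hold if the INFO bits were sent and measured in the `x` basis
(`probeVector_eq_fourier`). Bob's INFO outcome is not published. Summing over it forces, by
Parseval, the same `s'` on both sides of the form. Summing over `x` kills the cross term of `s` and
`t` unless `s + t + v ∈ V`, hence unless `s + t` has weight at least the distance `d` of `v` from
`V`. This cannot happen when `s` and `t` both lie at distance less than `d / 2` from `s'`.
Cauchy–Schwarz then bounds Eve's information by the square root of the probability of at least `d /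
2` errors on the INFO bits in the `x` basis (`norm_sum_form_le`).

In this conjugate protocol the bases depend on the TEST-Z positions only, so the law of the errors
ignores how the other positions are divided, while the INFO set is a uniformly random `n`-subset of
them. Passing TEST-X with that many INFO errors is a deviation of `ε n_x / (n + n_x)` from the mean
rate, which Hoeffding's inequality without replacement controls (`card_filter_powersetCard_le`,
`sum_undetected_le`). The square root halves the exponent. The constant is `1/2` times `m` key bits,
times `2` for the norm of a hybrid operator, times `2` for the two surviving Cauchy–Schwarz terms,
and `2 m ≤ 2 R n`. -/

open MeasureTheory ProbabilityTheory in
/-- Hoeffding's lemma for a Bernoulli variable. -/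
theorem one_add_exp_sub_one_mul_le {p : ℝ} (h0 : 0 ≤ p) (h1 : p ≤ 1) (t : ℝ) :
    1 + (Real.exp t - 1) * p ≤ Real.exp (t * p + t ^ 2 / 8) := by
  let μ : Measure ℝ := ENNReal.ofReal p • Measure.dirac 1 + ENNReal.ofReal (1 - p) • Measure.dirac 0
  have hint : ∀ f : ℝ → ℝ, Measurable f → ∫ x, f x ∂μ = p * f 1 + (1 - p) * f 0 := by
    intro f hf
    have hd : ∀ a c : ℝ, Integrable f (ENNReal.ofReal c • Measure.dirac a) := fun a c =>
      Integrable.smul_measure (integrable_dirac (by simp)) ENNReal.ofReal_ne_top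
    rw [integral_add_measure (hd _ _) (hd _ _), integral_smul_measure, integral_smul_measure,
      integral_dirac, integral_dirac, ENNReal.toReal_ofReal h0, ENNReal.toReal_ofReal (by linarith)]
    simp
  have : IsProbabilityMeasure μ := ⟨by
    simp only [μ, Measure.coe_add, Measure.coe_smul, Pi.add_apply, Pi.smul_apply, measure_univ,
      smul_eq_mul, mul_one]
    rw [← ENNReal.ofReal_add h0 (by linarith)]
    simp⟩
  have hmem : ∀ᵐ x ∂μ, id x ∈ Set.Icc (0 : ℝ) 1 := by
    rw [ae_iff]
    simp only [μ, Measure.coe_add, Measure.coe_smul, Pi.add_apply, Pi.smul_apply]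
    rw [Measure.dirac_apply, Measure.dirac_apply]
    simp [Set.indicator]
  -- Centred at its mean `p`, a variable with values in `[0, 1]` is sub-Gaussian with parameter
  -- `1/4`. Multiplying by `exp (t * p)` below undoes the centring.
  have h := (hasSubgaussianMGF_of_mem_Icc (μ := μ) (X := id) aemeasurable_id hmem).mgf_le t
  rw [mgf, hint _ measurable_id, hint _ (by fun_prop)] at h
  have hc : (((‖(1 : ℝ) - 0‖₊ / 2) ^ 2 : NNReal) : ℝ) * t ^ 2 / 2 = t ^ 2 / 8 := by
    simp; ring
  rw [hc] at h
  simp only [id_eq, mul_one, mul_zero, add_zero] at h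
  have h2 := mul_le_mul_of_nonneg_left h (Real.exp_pos (t * p)).le
  rw [← Real.exp_add, mul_add, mul_left_comm, mul_left_comm _ (1 - p), ← Real.exp_add,
    ← Real.exp_add] at h2
  have e1 : t * p + t * (1 - p) = t := by ring
  have e2 : t * p + t * (0 - p) = 0 := by ring
  rw [e1, e2, Real.exp_zero] at h2
  linarith

/-- Factor by factor, `(K - j) / (M - j) ≤ K / M`: sampling without replacement exhausts the smaller
set faster. -/
theorem descFactorial_mul_pow_le {K M : ℕ} (h : K ≤ M) (k : ℕ) :
    K.descFactorial k * M ^ k ≤ M.descFactorial k * K ^ k := by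
  induction k with
  | zero => simp
  | succ k ih =>
    rw [Nat.descFactorial_succ, Nat.descFactorial_succ, pow_succ, pow_succ]
    have h2 : (K - k) * M ≤ (M - k) * K := by
      rw [Nat.sub_mul, Nat.sub_mul, mul_comm M K]
      exact Nat.sub_le_sub_left (Nat.mul_le_mul_left k h) _
    calc (K - k) * K.descFactorial k * (M ^ k * M)
        = (K.descFactorial k * M ^ k) * ((K - k) * M) := by ring
      _ ≤ (M.descFactorial k * K ^ k) * ((M - k) * K) := Nat.mul_le_mul ih h2
      _ = _ := by ring

theorem choose_mul_pow_le {K M : ℕ} (h : K ≤ M) (k : ℕ) :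
    K.choose k * M ^ k ≤ M.choose k * K ^ k := by
  have := descFactorial_mul_pow_le h k
  rw [Nat.descFactorial_eq_factorial_mul_choose, Nat.descFactorial_eq_factorial_mul_choose,
    mul_assoc, mul_assoc] at this
  exact Nat.le_of_mul_le_mul_left this (Nat.factorial_pos k)

variable {α : Type*} [DecidableEq α]

/-- The moment generating function of a hypergeometric variable is at most the one of the
binomial variable with the same mean. -/
theorem sum_pow_card_inter_le {U C : Finset α} (hC : C ⊆ U) (n : ℕ) {y : ℝ} (hy : 0 ≤ y) :
    ∑ S ∈ U.powersetCard n, (1 + y) ^ (S ∩ C).card ≤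
      (U.card.choose n : ℝ) * (1 + y * (C.card / U.card)) ^ n := by
  -- The binomial theorem over subsets of `S ∩ C` reduces the sum to counting the sets `S` that
  -- contain a given `T`.
  have expand : ∀ S ∈ U.powersetCard n, (1 + y) ^ (S ∩ C).card =
      ∑ T ∈ C.powerset, if T ⊆ S then y ^ T.card else 0 := by
    intro S _
    rw [add_comm, ← Finset.sum_pow_mul_eq_add_pow y 1 (S ∩ C), ← Finset.sum_filter]
    refine Finset.sum_congr ?_ (by simp)
    ext T
    rw [Finset.mem_powerset, Finset.subset_inter_iff, Finset.mem_filter, Finset.mem_powerset,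
      and_comm]
  rw [Finset.sum_congr rfl expand, Finset.sum_comm]
  -- The guard matters: for `T.card > n` the truncated `n - T.card` is `0`, and the binomial
  -- coefficient would be `1` instead of `0`.
  have inner : ∀ T ∈ C.powerset, ∑ S ∈ U.powersetCard n, (if T ⊆ S then y ^ T.card else 0) =
      (if T.card ≤ n then ((U.card - T.card).choose (n - T.card) : ℝ) else 0) * y ^ T.card := by
    intro T hT
    rw [← Finset.sum_filter, Finset.sum_const, nsmul_eq_mul]
    congr 1
    have hTU : T ⊆ U := (Finset.mem_powerset.1 hT).trans hC
    split_ifs with hn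
    · rw [Finset.card_filter_powersetCard_subset _ _ _ hTU hn]
    · rw [Finset.filter_eq_empty_iff.2, Finset.card_empty, Nat.cast_zero]
      intro S hS hTS
      exact hn ((Finset.card_le_card hTS).trans (Finset.mem_powersetCard.1 hS).2.le)
  rw [Finset.sum_congr rfl inner, Finset.sum_powerset_apply_card
    (fun k => (if k ≤ n then ((U.card - k).choose (n - k) : ℝ) else 0) * y ^ k)]
  set K := C.card
  set M := U.card
  have hKM : K ≤ M := Finset.card_le_card hC
  by_cases hnM : n ≤ M
  swap
  · have hz : (M.choose n : ℝ) = 0 := by exact_mod_cast Nat.choose_eq_zero_of_lt (not_le.1 hnM)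
    rw [hz, zero_mul]
    refine (Finset.sum_eq_zero fun k hk => ?_).le
    have hk' : k ≤ K := Nat.lt_succ_iff.1 (Finset.mem_range.1 hk)
    split_ifs with h
    · rw [Nat.choose_eq_zero_of_lt (show M - k < n - k by omega)]; simp
    · simp
  rw [add_comm 1 (y * _), add_pow, Finset.mul_sum]
  have hterm : ∀ k, K.choose k • ((if k ≤ n then ((M - k).choose (n - k) : ℝ) else 0) * y ^ k) ≤
      if k ≤ n then (M.choose n : ℝ) * ((y * (K / M)) ^ k * 1 ^ (n - k) * (n.choose k)) else 0 := by
    intro k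
    split_ifs with hk
    swap
    · simp
    have h1 : (K.choose k : ℝ) ≤ M.choose k * (K / M : ℝ) ^ k := by
      rcases Nat.eq_zero_or_pos M with h0 | hpos
      · have hK0 : K = 0 := by omega
        have hk0 : k = 0 := by omega
        simp [h0, hK0, hk0]
      · rw [div_pow, ← mul_div_assoc, le_div_iff₀ (by positivity)]
        exact_mod_cast choose_mul_pow_le hKM k
    have h2 : (M.choose n : ℝ) * n.choose k = M.choose k * (M - k).choose (n - k) := by
      exact_mod_cast Nat.choose_mul hk
    calc K.choose k • (((M - k).choose (n - k) : ℝ) * y ^ k)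
        = K.choose k * (((M - k).choose (n - k) : ℝ) * y ^ k) := nsmul_eq_mul _ _
      _ ≤ M.choose k * (K / M : ℝ) ^ k * (((M - k).choose (n - k) : ℝ) * y ^ k) := by gcongr
      _ = (M.choose k * (M - k).choose (n - k)) * ((K / M : ℝ) ^ k * y ^ k) := by ring
      _ = _ := by rw [← h2, mul_pow]; ring
  calc _ ≤ ∑ k ∈ Finset.range (K + 1), if k ≤ n then
          (M.choose n : ℝ) * ((y * (K / M)) ^ k * 1 ^ (n - k) * (n.choose k)) else 0 :=
        Finset.sum_le_sum fun k _ => hterm k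
    _ ≤ _ := by
        rw [← Finset.sum_filter]
        refine Finset.sum_le_sum_of_subset_of_nonneg ?_ fun k _ _ => by positivity
        intro k hk
        rw [Finset.mem_filter] at hk
        exact Finset.mem_range.2 (Nat.lt_succ_of_le hk.2)

/-- Hoeffding's inequality for sampling without replacement. -/
theorem card_filter_powersetCard_le {U C : Finset α} (hC : C ⊆ U) (n : ℕ) {t : ℝ} (ht : 0 ≤ t) :
    (((U.powersetCard n).filter fun S =>
        (n : ℝ) * (C.card / U.card + t) ≤ (S ∩ C).card).card : ℝ) ≤
      Real.exp (-2 * n * t ^ 2) * (U.powersetCard n).card := by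
  set p : ℝ := C.card / U.card
  have hp0 : 0 ≤ p := by positivity
  have hp1 : p ≤ 1 := div_le_one_of_le₀ (by exact_mod_cast Finset.card_le_card hC) (by positivity)
  -- Chernoff's method with exponent `u = 4 * t`, the minimiser of `u ^ 2 / 8 - u * t`; the minimum
  -- is `-2 * t ^ 2`.
  have hexp : 0 ≤ Real.exp (4 * t) - 1 := by
    have := Real.one_le_exp (x := 4 * t) (by positivity); linarith
  have key := sum_pow_card_inter_le hC n hexp
  have hlow : (((U.powersetCard n).filter fun S =>
        (n : ℝ) * (p + t) ≤ (S ∩ C).card).card : ℝ) * Real.exp (4 * t * (n * (p + t))) ≤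
      ∑ S ∈ U.powersetCard n, (1 + (Real.exp (4 * t) - 1)) ^ (S ∩ C).card := by
    rw [← nsmul_eq_mul, ← Finset.sum_const]
    refine (Finset.sum_le_sum fun S hS => ?_).trans
      (Finset.sum_le_sum_of_subset_of_nonneg (Finset.filter_subset _ _) fun S _ _ => by positivity)
    rw [add_sub_cancel, ← Real.exp_nat_mul, Real.exp_le_exp]
    have := (Finset.mem_filter.1 hS).2
    nlinarith
  have hup : (1 + (Real.exp (4 * t) - 1) * p) ^ n ≤
      Real.exp (n * (4 * t * p + (4 * t) ^ 2 / 8)) := by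
    rw [Real.exp_nat_mul]
    exact pow_le_pow_left₀ (by positivity) (one_add_exp_sub_one_mul_le hp0 hp1 _) n
  have h := hlow.trans (key.trans (mul_le_mul_of_nonneg_left hup (by positivity)))
  rw [Finset.card_powersetCard]
  have hsplit : Real.exp (n * (4 * t * p + (4 * t) ^ 2 / 8)) =
      Real.exp (-2 * n * t ^ 2) * Real.exp (4 * t * (n * (p + t))) := by
    rw [← Real.exp_add]; ring_nf
  rw [hsplit, ← mul_assoc (Nat.cast _)] at h
  rw [mul_comm (Real.exp (-2 * n * t ^ 2))]
  exact le_of_mul_le_mul_right h (Real.exp_pos _)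

end Sampling

/-! ### The trace norm of a Hermitian matrix -/

/-- The matrix `K` defines a sesquilinear form of norm at most `C`. -/
def FormBound {E : Type*} [Fintype E] (C : ℝ) (K : Matrix E E ℂ) : Prop :=
  ∀ φ ψ : E → ℂ, ‖star φ ⬝ᵥ K.mulVec ψ‖ ≤
    C * (Real.sqrt (∑ e, ‖φ e‖ ^ 2) * Real.sqrt (∑ e, ‖ψ e‖ ^ 2))

theorem norm_dotProduct_le {E : Type*} [Fintype E] (φ ψ : E → ℂ) :
    ‖star φ ⬝ᵥ ψ‖ ≤ Real.sqrt (∑ e, ‖φ e‖ ^ 2) * Real.sqrt (∑ e, ‖ψ e‖ ^ 2) := by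
  have h := norm_inner_le_norm (𝕜 := ℂ) (WithLp.toLp 2 φ : EuclideanSpace ℂ E) (WithLp.toLp 2 ψ)
  rw [EuclideanSpace.norm_eq, EuclideanSpace.norm_eq] at h
  simpa [PiLp.inner_apply, dotProduct, mul_comm] using h

theorem star_dotProduct_self {E : Type*} [Fintype E] (φ : E → ℂ) :
    star φ ⬝ᵥ φ = ((∑ e, ‖φ e‖ ^ 2 : ℝ) : ℂ) := by
  push_cast
  exact Finset.sum_congr rfl fun e _ => by simpa using Complex.conj_mul' (φ e)

theorem formBound_one_of_unitary {E : Type*} [Fintype E] [DecidableEq E] {W : Matrix E E ℂ}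
    (hW : W.conjTranspose * W = 1) : FormBound 1 W := by
  intro φ ψ
  rw [one_mul]
  refine (norm_dotProduct_le _ _).trans (le_of_eq ?_)
  have : (∑ e, ‖W.mulVec ψ e‖ ^ 2 : ℝ) = ∑ e, ‖ψ e‖ ^ 2 := by
    have h : (star (W.mulVec ψ)) ⬝ᵥ W.mulVec ψ = star ψ ⬝ᵥ ψ := by
      rw [Matrix.star_mulVec, ← Matrix.dotProduct_mulVec, Matrix.mulVec_mulVec, hW,
        Matrix.one_mulVec]
    rw [star_dotProduct_self, star_dotProduct_self] at h
    exact_mod_cast h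
  rw [this]

-- `W` is the sign of `M` in the functional calculus, and `|M| = M * W`. The sign of `0` is taken to
-- be `1`, so that `W` squares to the identity even if `M` is singular.
open scoped MatrixOrder in
theorem exists_traceNorm_eq {α : Type*} [Fintype α] {M : Matrix α α ℂ}
    (hM : M.IsHermitian) :
    ∃ W : Matrix α α ℂ, FormBound 1 W ∧ traceNorm M = (M * W).trace.re := by
  classical
  have hsa : IsSelfAdjoint M := hM
  let f : ℝ → ℝ := fun x => if 0 ≤ x then 1 else -1
  have hf : ContinuousOn f (spectrum ℝ M) :=
    (Matrix.finite_real_spectrum).continuousOn f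
  refine ⟨cfc f M, formBound_one_of_unitary ?_, ?_⟩
  · have h1 : (cfc f M).conjTranspose = cfc f M := IsSelfAdjoint.cfc (f := f) (a := M)
    rw [h1, ← cfc_mul f f M hf hf, ← cfc_one ℝ M]
    refine cfc_congr fun x _ => ?_
    simp only [f]
    split_ifs <;> simp
  · rw [traceNorm, CFC.abs_eq_cfc_norm M hsa]
    congr 2
    nth_rewrite 2 [← cfc_id' ℝ M hsa]
    rw [← cfc_mul _ f M (by fun_prop) hf]
    refine cfc_congr fun x _ => ?_
    simp only [f]
    split_ifs with h
    · simp [abs_of_nonneg h]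
    · simp [abs_of_neg (not_le.1 h)]

/-! ### Fourier analysis on bit strings -/

theorem bit_cases : ∀ a : Bit, a = 0 ∨ a = 1 := by decide

theorem BitString.add_self {t : ℕ} (a : BitString t) : a + a = 0 :=
  funext fun j => CharTwo.add_self_eq_zero (a j)

theorem BitString.neg_eq {t : ℕ} (a : BitString t) : -a = a :=
  funext fun j => CharTwo.neg_eq (a j)

theorem BitString.add_eq_zero {t : ℕ} {a b : BitString t} : a + b = 0 ↔ a = b := by
  rw [add_eq_zero_iff_eq_neg, BitString.neg_eq]

/-- The nontrivial character of the field with two elements. -/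
def sgn (a : Bit) : ℂ := if a = 0 then 1 else -1

@[simp] theorem sgn_zero : sgn 0 = 1 := rfl

@[simp] theorem sgn_one : sgn 1 = -1 := by simp [sgn]

theorem sgn_add (a b : Bit) : sgn (a + b) = sgn a * sgn b := by
  have h2 : (1 : Bit) + 1 = 0 := rfl
  rcases bit_cases a with rfl | rfl <;> rcases bit_cases b with rfl | rfl <;> simp [h2]

@[simp] theorem star_sgn (a : Bit) : (starRingEnd ℂ) (sgn a) = sgn a := by
  unfold sgn; split_ifs <;> simp

theorem sgn_sum {ι : Type*} (s : Finset ι) (f : ι → Bit) :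
    sgn (∑ i ∈ s, f i) = ∏ i ∈ s, sgn (f i) := by
  classical
  induction s using Finset.induction_on with
  | empty => simp
  | insert a s ha ih => rw [Finset.sum_insert ha, Finset.prod_insert ha, sgn_add, ih]

theorem sum_sgn_dotProduct {n : ℕ} (w : BitString n) :
    ∑ x : BitString n, sgn (x ⬝ᵥ w) = if w = 0 then (2 : ℂ) ^ n else 0 := by
  split_ifs with h
  · simp [h]
  · obtain ⟨l, hl⟩ := Function.ne_iff.1 h
    have hl1 : w l = 1 := (bit_cases _).resolve_left hl
    have hs := Equiv.sum_comp (Equiv.addRight (Pi.single l 1 : BitString n))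
      (fun x => sgn (x ⬝ᵥ w))
    simp only [Equiv.coe_addRight, add_dotProduct, sgn_add, single_dotProduct, hl1,
      sgn_one, mul_neg, mul_one, Finset.sum_neg_distrib] at hs
    linear_combination (-1 / 2 : ℂ) * hs

variable {E : Type*} [Fintype E]

/-- The sesquilinear form of the matrix `K`. -/
def form (K : Matrix E E ℂ) (φ ψ : E → ℂ) : ℂ := star φ ⬝ᵥ K.mulVec ψ

theorem form_sum_left {ι : Type*} (s : Finset ι) (K : Matrix E E ℂ) (f : ι → E → ℂ) (ψ : E → ℂ) :
    form K (∑ i ∈ s, f i) ψ = ∑ i ∈ s, form K (f i) ψ := by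
  simp [form, star_sum, sum_dotProduct]

theorem form_sum_right {ι : Type*} (s : Finset ι) (K : Matrix E E ℂ) (φ : E → ℂ)
    (f : ι → E → ℂ) : form K φ (∑ i ∈ s, f i) = ∑ i ∈ s, form K φ (f i) := by
  simp [form, Matrix.mulVec_sum, dotProduct_sum]

theorem form_smul_left (K : Matrix E E ℂ) (c : ℂ) (φ ψ : E → ℂ) :
    form K (c • φ) ψ = star c * form K φ ψ := by
  simp [form]

theorem form_smul_right (K : Matrix E E ℂ) (c : ℂ) (φ ψ : E → ℂ) :
    form K φ (c • ψ) = c * form K φ ψ := by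
  simp [form, Matrix.mulVec_smul]

theorem form_smul (K : Matrix E E ℂ) (c : ℂ) (φ ψ : E → ℂ) :
    form (c • K) φ ψ = c * form K φ ψ := by
  simp [form, Matrix.smul_mulVec]

theorem form_sum {ι : Type*} (s : Finset ι) (K : ι → Matrix E E ℂ) (φ ψ : E → ℂ) :
    form (∑ i ∈ s, K i) φ ψ = ∑ i ∈ s, form (K i) φ ψ := by
  simp [form, Matrix.sum_mulVec, dotProduct_sum]

theorem form_sub (K L : Matrix E E ℂ) (φ ψ : E → ℂ) :
    form (K - L) φ ψ = form K φ ψ - form L φ ψ := by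
  simp [form, Matrix.sub_mulVec, dotProduct_sub]

/-- The Fourier transform of a vector valued function on bit strings. -/
def fourier {n : ℕ} (f : BitString n → E → ℂ) (x : BitString n) : E → ℂ :=
  ∑ s, sgn (x ⬝ᵥ s) • f s

theorem form_fourier {n : ℕ} (K : Matrix E E ℂ) (f g : BitString n → E → ℂ) (x : BitString n) :
    form K (fourier f x) (fourier g x) =
      ∑ s, ∑ t, sgn (x ⬝ᵥ (s + t)) * form K (f s) (g t) := by
  simp only [fourier, form_sum_left, form_sum_right, form_smul_left, form_smul_right,
    dotProduct_add, sgn_add, mul_assoc, Complex.star_def, star_sgn, Finset.mul_sum]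
  refine Finset.sum_comm.trans (Finset.sum_congr rfl fun s _ => Finset.sum_congr rfl fun t _ => ?_)
  ring

/-- Parseval's identity. -/
theorem sum_form_fourier {n : ℕ} (K : Matrix E E ℂ) (f g : BitString n → E → ℂ) :
    ∑ x, form K (fourier f x) (fourier g x) = 2 ^ n * ∑ s, form K (f s) (g s) := by
  simp only [form_fourier]
  rw [Finset.sum_comm, Finset.mul_sum]
  refine Finset.sum_congr rfl fun s _ => ?_
  rw [Finset.sum_comm, Finset.sum_eq_single s]
  · rw [← Finset.sum_mul, sum_sgn_dotProduct, if_pos (BitString.add_self s)]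
  · intro t _ hts
    rw [← Finset.sum_mul, sum_sgn_dotProduct, if_neg, zero_mul]
    intro h
    exact hts (BitString.add_eq_zero.1 h).symm
  · simp

/-- The squared norm of a vector. -/
def normSq (φ : E → ℂ) : ℝ := ∑ e, ‖φ e‖ ^ 2

theorem normSq_nonneg (φ : E → ℂ) : 0 ≤ normSq φ := Finset.sum_nonneg fun _ _ => by positivity

theorem sum_normSq_fourier {n : ℕ} (f : BitString n → E → ℂ) :
    ∑ x, normSq (fourier f x) = 2 ^ n * ∑ s, normSq (f s) := by
  classical
  have h := sum_form_fourier 1 f f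
  simp only [form, Matrix.one_mulVec, star_dotProduct_self] at h
  exact_mod_cast h

theorem FormBound.norm_form_le {C : ℝ} {K : Matrix E E ℂ} (h : FormBound C K) (φ ψ : E → ℂ) :
    ‖form K φ ψ‖ ≤ C * (Real.sqrt (normSq φ) * Real.sqrt (normSq ψ)) := h φ ψ

theorem FormBound.norm_sum_form_le {ι : Type*} (s : Finset ι) {C : ℝ} (hC : 0 ≤ C)
    {K : ι → Matrix E E ℂ} (h : ∀ i, FormBound C (K i)) (φ ψ : ι → E → ℂ) :
    ‖∑ i ∈ s, form (K i) (φ i) (ψ i)‖ ≤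
      C * (Real.sqrt (∑ i ∈ s, normSq (φ i)) * Real.sqrt (∑ i ∈ s, normSq (ψ i))) := by
  refine (norm_sum_le _ _).trans ((Finset.sum_le_sum fun i _ => (h i).norm_form_le _ _).trans ?_)
  rw [← Finset.mul_sum]
  exact mul_le_mul_of_nonneg_left (Real.sum_sqrt_mul_sqrt_le s (fun i => normSq_nonneg _)
    (fun i => normSq_nonneg _)) hC

/-! ### Distance to a subspace and the vanishing of short differences. -/

/-- A vector outside a subspace is separated from it by an element of the annihilator. -/
theorem exists_dotProduct_eq_one {n : ℕ} (V : Submodule Bit (BitString n)) {w : BitString n}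
    (hw : w ∉ V) : ∃ x : BitString n, (∀ u ∈ V, x ⬝ᵥ u = 0) ∧ x ⬝ᵥ w = 1 := by
  obtain ⟨f, hf, hV⟩ := Submodule.exists_le_ker_of_notMem hw
  have hfx : ∀ u, f u = (fun l => f (Pi.single l 1)) ⬝ᵥ u := by
    intro u
    conv_lhs => rw [pi_eq_sum_univ' u]
    simp [dotProduct, mul_comm]
  refine ⟨fun l => f (Pi.single l 1), fun u hu => ?_, ?_⟩
  · rw [← hfx]; exact hV hu
  · rw [← hfx]
    exact (bit_cases _).resolve_left hf

/-- Some `x₀` annihilates `V` but not `w + v`. Shifting `x` by it permutes the terms and changes the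
sign of each. -/
theorem sum_sgn_mul_form_eq_zero {n : ℕ} (V : Submodule Bit (BitString n)) (v w : BitString n)
    (K : BitString n → Matrix E E ℂ)
    (hK : ∀ x x₀, (∀ u ∈ V, x₀ ⬝ᵥ u = 0) → K (x + x₀) = sgn (x₀ ⬝ᵥ v) • K x)
    (hw : w + v ∉ V) (φ ψ : E → ℂ) :
    ∑ x, sgn (x ⬝ᵥ w) * form (K x) φ ψ = 0 := by
  obtain ⟨x₀, h0, h1⟩ := exists_dotProduct_eq_one V hw
  have hs := Equiv.sum_comp (Equiv.addRight x₀) (fun x => sgn (x ⬝ᵥ w) * form (K x) φ ψ)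
  have hneg : sgn (x₀ ⬝ᵥ w) * sgn (x₀ ⬝ᵥ v) = -1 := by
    rw [← sgn_add, ← dotProduct_add, h1, sgn_one]
  have hterm : ∀ x, sgn ((x + x₀) ⬝ᵥ w) * form (K (x + x₀)) φ ψ =
      -(sgn (x ⬝ᵥ w) * form (K x) φ ψ) := by
    intro x
    rw [hK x x₀ h0, form_smul, add_dotProduct, sgn_add]
    linear_combination (sgn (x ⬝ᵥ w) * form (K x) φ ψ) * hneg
  simp only [Equiv.coe_addRight, hterm, Finset.sum_neg_distrib] at hs
  linear_combination (-1 / 2 : ℂ) * hs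

theorem distToSubspace_le {n : ℕ} {v w : BitString n} {V : Submodule Bit (BitString n)}
    (h : w + v ∈ V) : distToSubspace v V ≤ hammingNorm w := by
  refine Nat.sInf_le ⟨w + v, h, ?_⟩
  rw [hammingDist_eq_hammingNorm, BitString.neg_eq, add_left_comm, BitString.add_self, add_zero]

theorem hammingNorm_add_le {n : ℕ} (a b : BitString n) :
    hammingNorm (a + b) ≤ hammingNorm a + hammingNorm b := by
  have h := hammingDist_triangle a 0 b
  rwa [hammingDist_eq_hammingNorm, hammingDist_zero_right, hammingDist_zero_left,
    BitString.neg_eq] at h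

/-- Strings `s` at distance less than `d / 2` from `s'` do not contribute. -/
theorem sum_form_fourier_eq_zero {n : ℕ} (V : Submodule Bit (BitString n)) (v : BitString n)
    (K : BitString n → Matrix E E ℂ)
    (hK : ∀ x x₀, (∀ u ∈ V, x₀ ⬝ᵥ u = 0) → K (x + x₀) = sgn (x₀ ⬝ᵥ v) • K x)
    (s' : BitString n) (G : BitString n → E → ℂ)
    (hG : ∀ s, distToSubspace v V ≤ 2 * hammingNorm (s + s') → G s = 0) :
    ∑ x, form (K x) (fourier G x) (fourier G x) = 0 := by
  simp only [form_fourier]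
  rw [Finset.sum_comm]
  refine Finset.sum_eq_zero fun s _ => ?_
  rw [Finset.sum_comm]
  refine Finset.sum_eq_zero fun t _ => ?_
  by_cases hs : distToSubspace v V ≤ 2 * hammingNorm (s + s')
  · simp [hG s hs, form]
  by_cases ht : distToSubspace v V ≤ 2 * hammingNorm (t + s')
  · simp [hG t ht, form]
  -- Both strings are closer to `s'` than half the distance, so `s + t` is shorter than the distance
  -- of `v` from `V`.
  refine sum_sgn_mul_form_eq_zero V v (s + t) K hK (fun h => ?_) _ _
  have h1 := distToSubspace_le h
  have h2 := hammingNorm_add_le (s + s') (t + s')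
  have h3 : s + s' + (t + s') = s + t := by
    rw [add_add_add_comm, BitString.add_self, add_zero]
  rw [h3] at h2
  omega

/-- If `F'` is the double Fourier transform of `F`, then Eve's information about a parity of the
strings `x` is bounded by the weight of the pairs `(s, s')` at a large distance. -/
theorem norm_sum_form_le {n : ℕ} (V : Submodule Bit (BitString n)) (v : BitString n)
    (K : BitString n → Matrix E E ℂ) {C : ℝ} (hC : 0 ≤ C) (hKC : ∀ x, FormBound C (K x))
    (hK : ∀ x x₀, (∀ u ∈ V, x₀ ⬝ᵥ u = 0) → K (x + x₀) = sgn (x₀ ⬝ᵥ v) • K x)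
    (F : BitString n → BitString n → E → ℂ) :
    ‖∑ x, ∑ x', form (K x) (fourier (fun s' => fourier (fun s => F s s') x) x')
        (fourier (fun s' => fourier (fun s => F s s') x) x')‖ ≤
      2 * C * (4 ^ n * (Real.sqrt (∑ s, ∑ s', normSq (F s s')) *
        Real.sqrt (∑ s, ∑ s', if distToSubspace v V ≤ 2 * hammingNorm (s + s') then
          normSq (F s s') else 0))) := by
  set T := ∑ s, ∑ s', normSq (F s s') with hT
  set B := ∑ s, ∑ s', if distToSubspace v V ≤ 2 * hammingNorm (s + s') then
          normSq (F s s') else 0 with hB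
  let bad : BitString n → BitString n → E → ℂ := fun s s' =>
    if distToSubspace v V ≤ 2 * hammingNorm (s + s') then F s s' else 0
  let good : BitString n → BitString n → E → ℂ := fun s s' =>
    if distToSubspace v V ≤ 2 * hammingNorm (s + s') then 0 else F s s'
  have hnz : normSq (0 : E → ℂ) = 0 := by simp [normSq]
  have hsplit : ∀ s' x, fourier (fun s => F s s') x =
      fourier (fun s => bad s s') x + fourier (fun s => good s s') x := by
    intro s' x
    simp only [fourier, ← Finset.sum_add_distrib, ← smul_add]
    refine Finset.sum_congr rfl fun s _ => ?_
    simp only [bad, good]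
    split_ifs <;> simp
  -- With `F = bad + good`, the form at `(F, F)` is the sum of those at `(F, bad)`, `(bad, good)`
  -- and `(good, good)`. The last sums to zero over `x`; the others each contain a bad factor,
  -- whence the `2` in the bound.
  have hdecomp : ∀ s' x, form (K x) (fourier (fun s => F s s') x) (fourier (fun s => F s s') x) =
      form (K x) (fourier (fun s => F s s') x) (fourier (fun s => bad s s') x) +
      form (K x) (fourier (fun s => bad s s') x) (fourier (fun s => good s s') x) +
      form (K x) (fourier (fun s => good s s') x) (fourier (fun s => good s s') x) := by
    intro s' x
    rw [hsplit]
    simp only [form, Matrix.mulVec_add, dotProduct_add, star_add, add_dotProduct]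
    ring
  have hzero : ∀ s', ∑ x, form (K x) (fourier (fun s => good s s') x)
      (fourier (fun s => good s s') x) = 0 := fun s' =>
    sum_form_fourier_eq_zero V v K hK s' _ fun s hs => if_pos hs
  have key : ∑ x, ∑ x', form (K x) (fourier (fun s' => fourier (fun s => F s s') x) x')
        (fourier (fun s' => fourier (fun s => F s s') x) x') =
      2 ^ n * (∑ p : BitString n × BitString n,
        form (K p.2) (fourier (fun s => F s p.1) p.2) (fourier (fun s => bad s p.1) p.2) +
      ∑ p : BitString n × BitString n,
        form (K p.2) (fourier (fun s => bad s p.1) p.2) (fourier (fun s => good s p.1) p.2)) := by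
    -- Parseval in `x'` leaves one common `s'` and a factor `2 ^ n`. The norms of the remaining
    -- transforms in `x` supply the second factor `2 ^ n` of `4 ^ n`.
    simp only [sum_form_fourier, Fintype.sum_prod_type]
    rw [← Finset.mul_sum, Finset.sum_comm, ← Finset.sum_add_distrib]
    congr 1
    refine Finset.sum_congr rfl fun s' _ => ?_
    rw [← Finset.sum_add_distrib, ← add_zero (∑ x, (_ + _)), ← hzero s', ← Finset.sum_add_distrib]
    exact Finset.sum_congr rfl fun x _ => hdecomp s' x
  have hnorm : ∀ H : BitString n → BitString n → E → ℂ,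
      ∑ p : BitString n × BitString n, normSq (fourier (fun s => H s p.1) p.2) =
        2 ^ n * ∑ s, ∑ s', normSq (H s s') := by
    intro H
    simp only [Fintype.sum_prod_type, sum_normSq_fourier]
    rw [← Finset.mul_sum, Finset.sum_comm]
  have hbad : ∑ s, ∑ s', normSq (bad s s') = B := by
    refine Finset.sum_congr rfl fun s _ => Finset.sum_congr rfl fun s' _ => ?_
    simp only [bad]
    split_ifs <;> simp [hnz]
  have hgood : ∑ s, ∑ s', normSq (good s s') ≤ T := by
    refine Finset.sum_le_sum fun s _ => Finset.sum_le_sum fun s' _ => ?_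
    simp only [good]
    split_ifs
    · rw [hnz]; exact normSq_nonneg _
    · exact le_rfl
  have h1 := FormBound.norm_sum_form_le Finset.univ hC
    (fun p : BitString n × BitString n => hKC p.2)
    (fun p => fourier (fun s => F s p.1) p.2) (fun p => fourier (fun s => bad s p.1) p.2)
  have h2 := FormBound.norm_sum_form_le Finset.univ hC
    (fun p : BitString n × BitString n => hKC p.2)
    (fun p => fourier (fun s => bad s p.1) p.2) (fun p => fourier (fun s => good s p.1) p.2)
  rw [hnorm, hnorm, hbad] at h1 h2
  have h2p : (0 : ℝ) ≤ 2 ^ n := by positivity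
  have hsq : ∀ a b : ℝ, Real.sqrt (2 ^ n * a) * Real.sqrt (2 ^ n * b) =
      2 ^ n * (Real.sqrt a * Real.sqrt b) := by
    intro a b
    rw [Real.sqrt_mul h2p, Real.sqrt_mul h2p, mul_mul_mul_comm, Real.mul_self_sqrt h2p]
  rw [hsq] at h1 h2
  have h3 : Real.sqrt B * Real.sqrt (∑ s, ∑ s', normSq (good s s')) ≤
      Real.sqrt T * Real.sqrt B := by
    rw [mul_comm]
    exact mul_le_mul_of_nonneg_right (Real.sqrt_le_sqrt hgood) (Real.sqrt_nonneg _)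
  rw [key, norm_mul, norm_pow, Complex.norm_ofNat]
  calc _ ≤ (2 : ℝ) ^ n * (C * (2 ^ n * (Real.sqrt T * Real.sqrt B)) +
        C * (2 ^ n * (Real.sqrt T * Real.sqrt B))) := by
        refine mul_le_mul_of_nonneg_left ((norm_add_le _ _).trans (add_le_add h1 (h2.trans ?_))) h2p
        gcongr
    _ = _ := by
        rw [show (4 : ℝ) ^ n = 2 ^ n * 2 ^ n by rw [← mul_pow]; norm_num]
        ring

/-! ### The hybrid argument over the bits of the key -/

section Hybrid

variable {m : ℕ} {E : Type*}

/-- The string with the first `l` bits of `k` and the other bits of `k'`. -/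
def mix (l : ℕ) (k k' : BitString m) : BitString m := fun j => if j.val < l then k j else k' j

/-- The average of `g` over all strings with the same first `l` bits. -/
def tailAverage (g : BitString m → Matrix E E ℂ) (l : ℕ) (k : BitString m) : Matrix E E ℂ :=
  -- The first `l` bits of `k'` are ignored, so each tail is counted `2 ^ l` times and the
  -- normalisation is by `2 ^ m`.
  ((2 : ℂ) ^ m)⁻¹ • ∑ k', g (mix l k k')

theorem card_bitString (t : ℕ) : Fintype.card (BitString t) = 2 ^ t := by
  simp [ZMod.card]

theorem tailAverage_last (g : BitString m → Matrix E E ℂ) (k : BitString m) :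
    tailAverage g m k = g k := by
  have : ∀ k', mix m k k' = k := fun k' => funext fun j => if_pos j.2
  simp only [tailAverage, this, Finset.sum_const, Finset.card_univ, card_bitString]
  rw [← Nat.cast_smul_eq_nsmul ℂ, smul_smul]
  simp

theorem tailAverage_zero (g : BitString m → Matrix E E ℂ) (k : BitString m) :
    tailAverage g 0 k = ((2 : ℂ) ^ m)⁻¹ • ∑ k', g k' := by
  have : ∀ k', mix 0 k k' = k' := fun k' => funext fun j => if_neg (Nat.not_lt_zero _)
  simp only [tailAverage, this]

/-- The part of `g` that depends on the first `l + 1` bits but averages to zero over the bit with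
index `l`. -/
def hybridDiff (g : BitString m → Matrix E E ℂ) (l : ℕ) (k : BitString m) : Matrix E E ℂ :=
  tailAverage g (l + 1) k - tailAverage g l k

theorem sum_hybridDiff (g : BitString m → Matrix E E ℂ) (k : BitString m) :
    ∑ l : Fin m, hybridDiff g l k = g k - ((2 : ℂ) ^ m)⁻¹ • ∑ k', g k' := by
  rw [Fin.sum_univ_eq_sum_range (fun l => hybridDiff g l k)]
  simp only [hybridDiff]
  rw [Finset.sum_range_sub (fun l => tailAverage g l k), tailAverage_last, tailAverage_zero]

theorem formBound_tailAverage [Fintype E] {g : BitString m → Matrix E E ℂ}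
    (hg : ∀ k, FormBound 1 (g k))
    (l : ℕ) (k : BitString m) : FormBound 1 (tailAverage g l k) := by
  intro φ ψ
  change ‖form (tailAverage g l k) φ ψ‖ ≤ _
  rw [tailAverage, form_smul, form_sum, norm_mul, norm_inv, norm_pow, Complex.norm_ofNat,
    inv_mul_le_iff₀ (by positivity)]
  refine (norm_sum_le _ _).trans ((Finset.sum_le_sum fun k' _ => (hg (mix l k k')) φ ψ).trans ?_)
  rw [Finset.sum_const, Finset.card_univ, card_bitString, nsmul_eq_mul]
  push_cast
  exact le_rfl

theorem formBound_hybridDiff [Fintype E] {g : BitString m → Matrix E E ℂ}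
    (hg : ∀ k, FormBound 1 (g k))
    (l : ℕ) (k : BitString m) : FormBound 2 (hybridDiff g l k) := by
  intro φ ψ
  change ‖form (hybridDiff g l k) φ ψ‖ ≤ _
  rw [hybridDiff, form_sub]
  refine (norm_sub_le _ _).trans ((add_le_add (formBound_tailAverage hg (l + 1) k φ ψ)
    (formBound_tailAverage hg l k φ ψ)).trans (le_of_eq ?_))
  ring

theorem mix_add (l : ℕ) {k k₀ : BitString m} (h : ∀ j : Fin m, j.val < l → k₀ j = 0)
    (k' : BitString m) : mix l (k + k₀) k' = mix l k k' := by
  funext j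
  simp only [mix]
  split_ifs with hj
  · simp [h j hj]
  · rfl

/-- The average over the two values of bit `l` of the tail average at `l + 1` is the tail average at
`l`, so the difference is odd in that bit. Later bits have been averaged out. -/
theorem hybridDiff_add (g : BitString m → Matrix E E ℂ) (l : Fin m) (k k₀ : BitString m)
    (h : ∀ j : Fin m, j < l → k₀ j = 0) :
    hybridDiff g l (k + k₀) = sgn (k₀ l) • hybridDiff g l k := by
  have hl : tailAverage g l (k + k₀) = tailAverage g l k := by
    simp only [tailAverage, mix_add (l : ℕ) (k := k) h]
  rcases bit_cases (k₀ l) with h0 | h1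
  · have hl1 : tailAverage g (l + 1) (k + k₀) = tailAverage g (l + 1) k := by
      have h' : ∀ j : Fin m, j.val < l + 1 → k₀ j = 0 := fun j hj => by
        rcases Nat.lt_succ_iff_lt_or_eq.1 hj with h2 | h2
        · exact h j h2
        · rw [Fin.ext h2, h0]
      simp only [tailAverage, mix_add (l + 1 : ℕ) (k := k) h']
    rw [hybridDiff, hl, hl1, h0, sgn_zero, one_smul, hybridDiff]
  · have hpair : ∀ k', g (mix (l + 1) k k') + g (mix (l + 1) (k + k₀) k') =
        g (mix l k k') + g (mix l k (k' + (Pi.single l 1 : BitString m))) := by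
      intro k'
      have hbit1 : ∀ a b : Bit, a = b ∨ a = b + 1 := by decide
      -- Here `κ` is `k'` or `k'` with bit `l` flipped, and `a` is its discrepancy from `k` at `l`.
      -- Mixing at `l` with `κ` is mixing at `l + 1` with `k` or `k + k₀`, according to `a`.
      have hcases : ∀ a : Bit, ∀ κ : BitString m, (κ l = k l + a) →
          (∀ j, j ≠ l → κ j = k' j) → (a = k₀ l ∨ a = 0) →
          mix l k κ = mix (l + 1) (if a = 0 then k else k + k₀) k' := by
        intro a κ hκl hκ ha
        funext j
        simp only [mix]
        rcases lt_trichotomy j.val l.val with hj | hj | hj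
        · rw [if_pos hj, if_pos (by omega)]
          split_ifs
          · rfl
          · simp [h j hj]
        · have hjl : j = l := Fin.ext hj
          subst hjl
          rw [if_neg (lt_irrefl _), if_pos (by omega), hκl]
          split_ifs with ha0
          · simp [ha0]
          · rw [ha.resolve_right ha0]; rfl
        · rw [if_neg (by omega), if_neg (by omega)]
          exact hκ j fun hjl => by subst hjl; exact lt_irrefl _ hj
      have hne : ∀ j, j ≠ l → (k' + Pi.single l 1 : BitString m) j = k' j := fun j hj => by simp [hj]
      have hs : (k' + Pi.single l 1 : BitString m) l = k' l + 1 := by simp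
      have h2 : (1 : Bit) + 1 = 0 := rfl
      rcases hbit1 (k' l) (k l) with hk | hk
      · have e1 := hcases 0 k' (by simp [hk]) (fun _ _ => rfl) (Or.inr rfl)
        have e2 := hcases 1 _ (by rw [hs, hk]) hne (Or.inl h1.symm)
        rw [e1, e2, if_pos rfl, if_neg one_ne_zero]
      · have e1 := hcases 1 k' hk (fun _ _ => rfl) (Or.inl h1.symm)
        have e2 := hcases 0 _ (by rw [hs, hk, add_assoc, h2]) hne (Or.inr rfl)
        rw [e1, e2, if_pos rfl, if_neg one_ne_zero, add_comm]
    have hsum : tailAverage g (l + 1) k + tailAverage g (l + 1) (k + k₀) =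
        tailAverage g l k + tailAverage g l k := by
      have hshift : ∑ k', g (mix l k (k' + (Pi.single l 1 : BitString m))) = ∑ k', g (mix l k k') :=
        Equiv.sum_comp (Equiv.addRight (Pi.single l 1 : BitString m)) fun k' => g (mix l k k')
      simp only [tailAverage]
      rw [← smul_add, ← smul_add, ← Finset.sum_add_distrib, Finset.sum_congr rfl
        (fun k' _ => hpair k'), Finset.sum_add_distrib, hshift]
    rw [hybridDiff, hybridDiff, hl, h1, sgn_one, neg_one_smul, neg_sub, sub_eq_sub_iff_add_eq_add,
      add_comm, hsum]

end Hybrid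

/-! ### Operators that depend on the syndrome and on the key -/

namespace Params

theorem syndrome_apply (Q : Params) (x : BitString Q.n) (j : Fin Q.r) :
    Q.syndrome x j = x ⬝ᵥ Q.rows (Fin.castAdd Q.m j) := by
  rw [rows, Fin.append_left]
  rfl

theorem key_apply (Q : Params) (x : BitString Q.n) (j : Fin Q.m) :
    Q.key x j = x ⬝ᵥ Q.rows (Fin.natAdd Q.r j) := by
  rw [rows, Fin.append_right]
  rfl

/-- The span of the rows that precede the row number `l` of the privacy amplification matrix. -/
def precedingSpan (Q : Params) (l : Fin Q.m) : Submodule Bit (BitString Q.n) :=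
  Submodule.span Bit (Q.rows '' {l' | l' < Fin.natAdd Q.r l})

theorem minDist_le (Q : Params) (l : Fin Q.m) :
    minDist Q.rows ≤ distToSubspace (Q.rows (Fin.natAdd Q.r l)) (Q.precedingSpan l) :=
  ciInf_le (OrderBot.bddBelow _) l

/-- A shift orthogonal to the preceding rows changes neither the syndrome nor the key bits before
`l`, and it flips key bit `l` by its product with row `l`. This is the covariance required by
`norm_sum_form_le`. -/
theorem hybridDiff_key_add {E : Type*} (Q : Params)
    (G : BitString Q.r → Q.Key → Matrix E E ℂ) (l : Fin Q.m) (x x₀ : BitString Q.n)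
    (hx₀ : ∀ u ∈ Q.precedingSpan l, x₀ ⬝ᵥ u = 0) :
    hybridDiff (G (Q.syndrome (x + x₀))) l (Q.key (x + x₀)) =
      sgn (x₀ ⬝ᵥ Q.rows (Fin.natAdd Q.r l)) • hybridDiff (G (Q.syndrome x)) l (Q.key x) := by
  have hrow : ∀ l' < Fin.natAdd Q.r l, x₀ ⬝ᵥ Q.rows l' = 0 := fun l' hl' =>
    hx₀ _ (Submodule.subset_span ⟨l', hl', rfl⟩)
  have hs : Q.syndrome (x + x₀) = Q.syndrome x := by
    funext j
    rw [syndrome_apply, syndrome_apply, add_dotProduct, hrow _ ?_, add_zero]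
    rw [Fin.lt_def, Fin.val_castAdd, Fin.val_natAdd]
    omega
  have hk : Q.key (x + x₀) = Q.key x + Q.key x₀ := by
    simp [key, Matrix.add_vecMul]
  rw [hs, hk, hybridDiff_add, key_apply]
  intro j hj
  rw [key_apply]
  refine hrow _ ?_
  rw [Fin.lt_def, Fin.val_natAdd, Fin.val_natAdd]
  omega

end Params

/-! ### The probes in the two bases -/

theorem sum_bit {M : Type*} [AddCommMonoid M] (f : Bit → M) : ∑ a : Bit, f a = f 0 + f 1 :=
  Fin.sum_univ_two f

theorem inv_sqrt_two_mul_self : ((Real.sqrt 2 : ℂ))⁻¹ * ((Real.sqrt 2 : ℂ))⁻¹ = 1 / 2 := by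
  rw [← mul_inv, ← Complex.ofReal_mul, Real.mul_self_sqrt (by norm_num)]
  norm_num

theorem ket_zero_eq (i : Bit) :
    ket 0 i = (Real.sqrt 2 : ℂ)⁻¹ • ∑ s, sgn (i * s) • ket 1 s := by
  have h := inv_sqrt_two_mul_self
  funext t
  rcases bit_cases i with rfl | rfl <;> rcases bit_cases t with rfl | rfl <;>
    simp [ket, sum_bit] <;> linear_combination (-2 : ℂ) * h

theorem sum_normSq_ket_mul (b : Bit) (f : Bit → ℂ) :
    ∑ i', ‖∑ t, star (ket b i' t) * f t‖ ^ 2 = ∑ t, ‖f t‖ ^ 2 := by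
  rcases bit_cases b with rfl | rfl
  · simp [ket]
  · have h : ∀ a c : ℂ, ‖(Real.sqrt 2 : ℂ)⁻¹ * a + (Real.sqrt 2 : ℂ)⁻¹ * c‖ ^ 2 +
        ‖(Real.sqrt 2 : ℂ)⁻¹ * a + -((Real.sqrt 2 : ℂ)⁻¹ * c)‖ ^ 2 = ‖a‖ ^ 2 + ‖c‖ ^ 2 := by
      intro a c
      rw [← sub_eq_add_neg, ← mul_add, ← mul_sub, norm_mul, norm_mul, mul_pow, mul_pow, ← mul_add]
      have h1 := parallelogram_law_with_norm ℝ a c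
      have h2 : ‖(Real.sqrt 2 : ℂ)⁻¹‖ ^ 2 = 1 / 2 := by
        rw [norm_inv, Complex.norm_real, Real.norm_eq_abs, inv_pow, sq_abs,
          Real.sq_sqrt (by norm_num)]
        norm_num
      rw [h2]
      linarith [h1]
    simpa [ket, sum_bit] using h (f 0) (f 1)

namespace CollectiveAttack

variable {N : ℕ} (A : CollectiveAttack N)

/-- The joint state of the `j`-th probe and the `j`-th qubit after Eve's unitary. -/
def evolved (j : Fin N) (b i : Bit) : Fin (A.dim j) × Bit → ℂ :=
  (A.U j : Matrix (Fin (A.dim j) × Bit) (Fin (A.dim j) × Bit) ℂ).mulVec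
    (fun p => A.init j p.1 * ket b i p.2)

theorem branch_apply (j : Fin N) (b i i' : Bit) (e : Fin (A.dim j)) :
    A.branch j b i i' e = ∑ t : Bit, star (ket b i' t) * A.evolved j b i (e, t) := rfl

theorem evolved_zero (j : Fin N) (i : Bit) :
    A.evolved j 0 i = (Real.sqrt 2 : ℂ)⁻¹ • ∑ s, sgn (i * s) • A.evolved j 1 s := by
  simp only [evolved, ← Matrix.mulVec_smul, ← Matrix.mulVec_sum]
  congr 1
  funext p
  rw [ket_zero_eq]
  simp only [Pi.smul_apply, Finset.sum_apply, smul_eq_mul, Finset.mul_sum]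
  exact Finset.sum_congr rfl fun s _ => by ring

theorem branch_zero (j : Fin N) (i i' : Bit) (e : Fin (A.dim j)) :
    A.branch j 0 i i' e =
      2⁻¹ * ∑ s', ∑ s, sgn (i' * s') * (sgn (i * s) * A.branch j 1 s s' e) := by
  rw [inv_eq_one_div, ← inv_sqrt_two_mul_self]
  simp only [branch_apply, evolved_zero, ket_zero_eq i', sum_bit, Pi.smul_apply, Pi.add_apply,
    smul_eq_mul, star_mul', star_add, Complex.star_def, star_sgn, map_inv₀, Complex.conj_ofReal]
  ring

theorem normSq_evolved (j : Fin N) (b i : Bit) : normSq (A.evolved j b i) = 1 := by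
  have hU := (Matrix.mem_unitaryGroup_iff').1 (A.U j).2
  have hket : ∑ t, ‖ket b i t‖ ^ 2 = 1 := by
    have hs : ‖(Real.sqrt 2 : ℂ)⁻¹‖ ^ 2 = 1 / 2 := by
      rw [norm_inv, Complex.norm_real, Real.norm_eq_abs, inv_pow, sq_abs,
        Real.sq_sqrt (by norm_num)]
      norm_num
    rcases bit_cases b with rfl | rfl <;> rcases bit_cases i with rfl | rfl <;>
      simp only [ket, sum_bit] <;> simp <;> norm_num at hs ⊢
  have hinit : ∑ e, ‖A.init j e‖ ^ 2 = 1 := by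
    have h1 := A.init_unit j
    rw [EuclideanSpace.norm_eq, Real.sqrt_eq_one] at h1
    exact h1
  have h : star (A.evolved j b i) ⬝ᵥ A.evolved j b i =
      star (fun p : Fin (A.dim j) × Bit => A.init j p.1 * ket b i p.2) ⬝ᵥ
        (fun p : Fin (A.dim j) × Bit => A.init j p.1 * ket b i p.2) := by
    rw [evolved, Matrix.star_mulVec, ← Matrix.dotProduct_mulVec, Matrix.mulVec_mulVec,
      ← Matrix.star_eq_conjTranspose, hU, Matrix.one_mulVec]
  rw [star_dotProduct_self, star_dotProduct_self] at h
  rw [normSq, Complex.ofReal_injective h, Fintype.sum_prod_type]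
  simp only [norm_mul, mul_pow, ← Finset.mul_sum, hket, mul_one, hinit]

theorem sum_normSq_branch (j : Fin N) (b i : Bit) :
    ∑ i', ∑ e, ‖A.branch j b i i' e‖ ^ 2 = 1 := by
  rw [Finset.sum_comm, ← A.normSq_evolved j b i, normSq, Fintype.sum_prod_type]
  exact Finset.sum_congr rfl fun e _ => sum_normSq_ket_mul b fun t => A.evolved j b i (e, t)

theorem normSq_probeVector (b i iB : BitString N) :
    normSq (A.probeVector b i iB) = A.outcomeProb b i iB := by
  simp only [normSq, probeVector, outcomeProb, norm_prod, ← Finset.prod_pow]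
  rw [Finset.prod_univ_sum, Fintype.piFinset_univ]

theorem outcomeProb_nonneg (b i iB : BitString N) : 0 ≤ A.outcomeProb b i iB := by
  rw [← normSq_probeVector]; exact normSq_nonneg _

theorem sum_outcomeProb (b i : BitString N) : ∑ iB, A.outcomeProb b i iB = 1 := by
  have h := Finset.prod_univ_sum (fun _ : Fin N => (Finset.univ : Finset Bit))
    (fun j i' => ∑ e, ‖A.branch j (b j) (i j) i' e‖ ^ 2)
  rw [Fintype.piFinset_univ] at h
  simp only [outcomeProb]
  rw [← h]
  exact Finset.prod_eq_one fun j _ => A.sum_normSq_branch j _ _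

theorem outcomeProb_smul_eveState (b i iB : BitString N) :
    (A.outcomeProb b i iB : ℂ) • A.eveState b i iB =
      Matrix.vecMulVec (A.probeVector b i iB) (star (A.probeVector b i iB)) := by
  rw [eveState, smul_smul]
  -- At probability zero the state defaults to the zero matrix, which is consistent because the
  -- probe vector vanishes too.
  by_cases h : A.outcomeProb b i iB = 0
  · have h0 : A.probeVector b i iB = 0 := by
      rw [← normSq_probeVector, normSq, Finset.sum_eq_zero_iff_of_nonneg (by intros; positivity)] at h
      funext e
      simpa using h e (Finset.mem_univ e)
    simp [h0]
  · rw [mul_inv_cancel₀ (by exact_mod_cast h), one_smul]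

end CollectiveAttack

/-! ### Partitions of the qubits -/

namespace Params

variable {Q : Params}

theorem cover (P : Q.Partition) (j : Fin Q.N) : P.1.1 j + P.1.2.1 j + P.1.2.2 j = 1 := by
  have h := P.2.2.2.2
  rw [hammingNorm] at h
  have h2 : (Finset.univ.filter fun j => (P.1.1 + P.1.2.1 + P.1.2.2) j ≠ 0) = Finset.univ := by
    rw [← Finset.card_eq_iff_eq_univ, Fintype.card_fin]; exact h
  have h3 := (Finset.filter_eq_self.1 h2) j (Finset.mem_univ j)
  exact (bit_cases _).resolve_left h3

/-- The positions of the INFO, TEST-Z and TEST-X bits. -/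
def position (P : Q.Partition) : Fin Q.n ⊕ (Fin Q.nz ⊕ Fin Q.nx) → Fin Q.N :=
  Sum.elim (Finset.orderEmbOfFin (Finset.univ.filter fun j => P.1.1 j ≠ 0) P.2.1)
    (Sum.elim (Finset.orderEmbOfFin (Finset.univ.filter fun j => P.1.2.1 j ≠ 0) P.2.2.1)
      (Finset.orderEmbOfFin (Finset.univ.filter fun j => P.1.2.2 j ≠ 0) P.2.2.2.1))

theorem exists_orderEmbOfFin_eq {N k : ℕ} {s : BitString N} (hs : hammingNorm s = k) {j : Fin N}
    (hj : s j ≠ 0) :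
    ∃ l, Finset.orderEmbOfFin (Finset.univ.filter fun j => s j ≠ 0) hs l = j :=
  (Set.ext_iff.1 (Finset.range_orderEmbOfFin (Finset.univ.filter fun j => s j ≠ 0) hs) j).2
    (by simpa using hj)

theorem apply_orderEmbOfFin_ne_zero {N k : ℕ} {s : BitString N} (hs : hammingNorm s = k)
    (l : Fin k) : s (Finset.orderEmbOfFin (Finset.univ.filter fun j => s j ≠ 0) hs l) ≠ 0 :=
  (Finset.mem_filter.1 (Finset.orderEmbOfFin_mem _ hs l)).2

/-- Coordinatewise the three strings only have odd sum, which gives surjectivity. Disjointness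
follows by counting, since the weights add up to `N`. -/
theorem position_bijective (P : Q.Partition) : Function.Bijective (position P) := by
  rw [Fintype.bijective_iff_surjective_and_card]
  refine ⟨fun j => ?_, by simp [add_assoc]⟩
  have hc := cover P j
  by_cases h1 : P.1.1 j ≠ 0
  · obtain ⟨l, hl⟩ := exists_orderEmbOfFin_eq P.2.1 h1
    exact ⟨Sum.inl l, hl⟩
  by_cases h2 : P.1.2.1 j ≠ 0
  · obtain ⟨l, hl⟩ := exists_orderEmbOfFin_eq P.2.2.1 h2
    exact ⟨Sum.inr (Sum.inl l), hl⟩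
  rw [not_not.1 h1, not_not.1 h2, zero_add, zero_add] at hc
  obtain ⟨l, hl⟩ := exists_orderEmbOfFin_eq P.2.2.2.1 (s := P.1.2.2) (j := j) (by simp [hc])
  exact ⟨Sum.inr (Sum.inr l), hl⟩

/-- The positions, as an equivalence. -/
def positionEquiv (P : Q.Partition) : Fin Q.n ⊕ (Fin Q.nz ⊕ Fin Q.nx) ≃ Fin Q.N :=
  Equiv.ofBijective (position P) (position_bijective P)

theorem basis_info (P : Q.Partition) (l : Fin Q.n) :
    P.1.2.1 (position P (Sum.inl l)) = 0 ∧ P.1.2.2 (position P (Sum.inl l)) = 0 := by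
  constructor <;> by_contra h
  · obtain ⟨l', hl'⟩ := exists_orderEmbOfFin_eq P.2.2.1 h
    have := (position_bijective P).1 (a₁ := Sum.inr (Sum.inl l')) (a₂ := Sum.inl l) hl'
    simp at this
  · obtain ⟨l', hl'⟩ := exists_orderEmbOfFin_eq P.2.2.2.1 h
    have := (position_bijective P).1 (a₁ := Sum.inr (Sum.inr l')) (a₂ := Sum.inl l) hl'
    simp at this

theorem info_eq_zero_of_test (P : Q.Partition) (l : Fin Q.nz ⊕ Fin Q.nx) :
    P.1.1 (position P (Sum.inr l)) = 0 := by
  by_contra h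
  obtain ⟨l', hl'⟩ := exists_orderEmbOfFin_eq P.2.1 h
  have := (position_bijective P).1 (a₁ := Sum.inl l') (a₂ := Sum.inr l) hl'
  simp at this

/-- The bases of the protocol in which the INFO bits are sent in the `x` basis. -/
def conjugateBases (P : Q.Partition) : BitString Q.N := 1 + P.1.2.1

theorem conjugateBases_info (P : Q.Partition) (l : Fin Q.n) :
    conjugateBases P (position P (Sum.inl l)) = 1 := by
  rw [conjugateBases, Pi.add_apply, (basis_info P l).1]; rfl

theorem conjugateBases_test (P : Q.Partition) (l : Fin Q.nz ⊕ Fin Q.nx) :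
    conjugateBases P (position P (Sum.inr l)) = bases P (position P (Sum.inr l)) := by
  have h := cover P (position P (Sum.inr l))
  rw [info_eq_zero_of_test, zero_add] at h
  rw [conjugateBases, Pi.add_apply, Pi.one_apply, ← h, bases, add_right_comm,
    CharTwo.add_self_eq_zero, zero_add]

/-- Bit strings of length `N` as triples of their INFO, TEST-Z and TEST-X bits. -/
def split (P : Q.Partition) :
    BitString Q.N ≃ BitString Q.n × (BitString Q.nz × BitString Q.nx) :=
  ((Equiv.arrowCongr (positionEquiv P).symm (Equiv.refl Bit)).trans
    (Equiv.sumArrowEquivProdArrow _ _ _)).trans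
      (Equiv.prodCongr (Equiv.refl _) (Equiv.sumArrowEquivProdArrow _ _ _))

theorem split_apply (P : Q.Partition) (i : BitString Q.N) :
    split P i = (info P i, (testZ P i, testX P i)) := rfl

theorem split_symm_info (P : Q.Partition) (x : BitString Q.n)
    (τ : BitString Q.nz × BitString Q.nx) (l : Fin Q.n) :
    (split P).symm (x, τ) (position P (Sum.inl l)) = x l := by
  have h := (split P).apply_symm_apply (x, τ)
  rw [split_apply] at h
  exact congrFun (congrArg Prod.fst h) l

theorem split_symm_test (P : Q.Partition) (x x' : BitString Q.n)
    (τ : BitString Q.nz × BitString Q.nx) (l : Fin Q.nz ⊕ Fin Q.nx) :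
    (split P).symm (x, τ) (position P (Sum.inr l)) =
      (split P).symm (x', τ) (position P (Sum.inr l)) := by
  have h := (split P).apply_symm_apply (x, τ)
  have h' := (split P).apply_symm_apply (x', τ)
  rw [split_apply] at h h'
  have h2 := (congrArg Prod.snd h).trans (congrArg Prod.snd h').symm
  rcases l with l | l
  · exact congrFun (congrArg Prod.fst h2) l
  · exact congrFun (congrArg Prod.snd h2) l

theorem prod_position {M : Type*} [CommMonoid M] (P : Q.Partition) (f : Fin Q.N → M) :
    ∏ j, f j = (∏ l, f (position P (Sum.inl l))) * ∏ l, f (position P (Sum.inr l)) := by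
  rw [← Equiv.prod_comp (positionEquiv P), Fintype.prod_sum_type]
  rfl

/-- Eve's states in the `z` basis are the Fourier transforms of her states in the `x` basis. -/
theorem probeVector_eq_fourier (A : CollectiveAttack Q.N) (P : Q.Partition)
    (τ τB : BitString Q.nz × BitString Q.nx) (x xB : BitString Q.n) :
    A.probeVector (bases P) ((split P).symm (x, τ)) ((split P).symm (xB, τB)) =
      ((2 : ℂ) ^ Q.n)⁻¹ • fourier (fun s' => fourier (fun s => A.probeVector (conjugateBases P)
        ((split P).symm (s, τ)) ((split P).symm (s', τB))) x) xB := by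
  funext e
  simp only [fourier, Pi.smul_apply, Finset.sum_apply, smul_eq_mul, CollectiveAttack.probeVector]
  rw [prod_position P]
  -- The factor of the test positions, where the two choices of bases agree; it does not involve the
  -- INFO strings.
  set R := ∏ l, A.branch (position P (Sum.inr l)) (bases P (position P (Sum.inr l)))
    ((split P).symm (x, τ) (position P (Sum.inr l)))
    ((split P).symm (xB, τB) (position P (Sum.inr l))) (e (position P (Sum.inr l))) with hR
  have hx : ∀ s s', ∏ j, A.branch j (conjugateBases P j) ((split P).symm (s, τ) j)
      ((split P).symm (s', τB) j) (e j) =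
      (∏ l, A.branch (position P (Sum.inl l)) 1 (s l) (s' l) (e (position P (Sum.inl l)))) * R := by
    intro s s'
    rw [prod_position P, hR]
    congr 1
    · exact Finset.prod_congr rfl fun l _ => by
        rw [conjugateBases_info, split_symm_info, split_symm_info]
    · exact Finset.prod_congr rfl fun l _ => by
        rw [conjugateBases_test, split_symm_test P s x, split_symm_test P s' xB]
  have hz : ∀ l, A.branch (position P (Sum.inl l)) (bases P (position P (Sum.inl l)))
      ((split P).symm (x, τ) (position P (Sum.inl l)))
      ((split P).symm (xB, τB) (position P (Sum.inl l))) (e (position P (Sum.inl l))) =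
      2⁻¹ * ∑ s', ∑ s, sgn (xB l * s') * (sgn (x l * s) *
        A.branch (position P (Sum.inl l)) 1 s s' (e (position P (Sum.inl l)))) := by
    intro l
    rw [split_symm_info, split_symm_info, bases, (basis_info P l).2, CollectiveAttack.branch_zero]
  simp only [hx, hz, Finset.prod_mul_distrib, Finset.prod_const, Finset.card_univ,
    Fintype.card_fin, inv_pow]
  rw [mul_assoc]
  congr 1
  rw [Finset.prod_univ_sum, Fintype.piFinset_univ, Finset.sum_mul]
  refine Finset.sum_congr rfl fun s' _ => ?_
  rw [Finset.prod_univ_sum, Fintype.piFinset_univ, Finset.sum_mul, Finset.mul_sum]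
  refine Finset.sum_congr rfl fun s _ => ?_
  rw [Finset.prod_mul_distrib, Finset.prod_mul_distrib, dotProduct, dotProduct, sgn_sum, sgn_sum]
  ring

end Params

/-! ### The random partition -/

theorem hammingNorm_substring {N k : ℕ} (s : BitString N) (hs : hammingNorm s = k)
    (c : BitString N) : hammingNorm (substring s hs c) =
      (Finset.univ.filter fun j => s j ≠ 0 ∧ c j ≠ 0).card := by
  rw [hammingNorm, ← Finset.card_map
    (Finset.orderEmbOfFin (Finset.univ.filter fun j => s j ≠ 0) hs).toEmbedding]
  congr 1
  ext j
  simp only [Finset.mem_map, Finset.mem_filter, Finset.mem_univ, true_and]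
  constructor
  · rintro ⟨l, hl, rfl⟩
    exact ⟨Params.apply_orderEmbOfFin_ne_zero hs l, hl⟩
  · rintro ⟨h1, h2⟩
    obtain ⟨l, rfl⟩ := Params.exists_orderEmbOfFin_eq hs h1
    exact ⟨l, h2, rfl⟩

namespace Params

variable {Q : Params}

theorem eq_zero_of_info (P : Q.Partition) {j : Fin Q.N} (h : P.1.1 j ≠ 0) :
    P.1.2.1 j = 0 ∧ P.1.2.2 j = 0 := by
  obtain ⟨l, rfl⟩ := exists_orderEmbOfFin_eq P.2.1 h
  exact basis_info P l

theorem basis_ne_zero_iff (P : Q.Partition) (j : Fin Q.N) :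
    P.1.2.2 j ≠ 0 ↔ P.1.2.1 j = 0 ∧ P.1.1 j = 0 := by
  have hc := cover P j
  constructor
  · intro h
    have hs : P.1.1 j = 0 := by
      by_contra hs
      exact h (eq_zero_of_info P hs).2
    rw [hs, (bit_cases _).resolve_left h, zero_add, add_eq_right] at hc
    exact ⟨hc, hs⟩
  · rintro ⟨hz, hs⟩
    rw [hz, hs, zero_add, zero_add] at hc
    simp [hc]

/-- The positions that are not TEST-Z positions. -/
def nonZ (z : BitString Q.N) : Finset (Fin Q.N) := Finset.univ.filter fun j => z j = 0

/-- The INFO positions. -/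
def infoSet (P : Q.Partition) : Finset (Fin Q.N) := Finset.univ.filter fun j => P.1.1 j ≠ 0

theorem card_nonZ {z : BitString Q.N} (hz : hammingNorm z = Q.nz) :
    (nonZ z).card = Q.n + Q.nx := by
  have h := Finset.card_filter_add_card_filter_not (s := (Finset.univ : Finset (Fin Q.N)))
    (fun j => z j = 0)
  rw [Finset.card_univ, Fintype.card_fin] at h
  have h2 : (Finset.univ.filter fun j => ¬ z j = 0).card = Q.nz := by
    rw [← hz, hammingNorm]
  rw [h2] at h
  change _ = Q.n + Q.nz + Q.nx at h
  rw [nonZ]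
  omega

theorem infoSet_mem (P : Q.Partition) : infoSet P ∈ (nonZ P.1.2.1).powersetCard Q.n := by
  rw [Finset.mem_powersetCard]
  refine ⟨fun j hj => ?_, P.2.1⟩
  simp only [infoSet, nonZ, Finset.mem_filter, Finset.mem_univ, true_and] at hj ⊢
  exact (eq_zero_of_info P hj).1

theorem partition_ext {P P' : Q.Partition} (hz : P.1.2.1 = P'.1.2.1)
    (hs : infoSet P = infoSet P') : P = P' := by
  have h1 : P.1.1 = P'.1.1 := by
    funext j
    have h := Finset.ext_iff.1 hs j
    simp only [infoSet, Finset.mem_filter, Finset.mem_univ, true_and] at h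
    rcases bit_cases (P.1.1 j) with h0 | h0 <;> rcases bit_cases (P'.1.1 j) with h0' | h0' <;>
      simp_all
  have h2 : P.1.2.2 = P'.1.2.2 := by
    funext j
    have h := (cover P j).trans (cover P' j).symm
    rw [hz, h1] at h
    exact add_left_cancel h
  exact Subtype.ext (Prod.ext h1 (Prod.ext hz h2))

/-- With `partition_ext`, this identifies the partitions with given `z` with the `n`-subsets of the
remaining positions, so that the INFO set is a uniform sample. -/
theorem exists_partition {z : BitString Q.N} (hz : hammingNorm z = Q.nz) {S : Finset (Fin Q.N)}
    (hS : S ∈ (nonZ z).powersetCard Q.n) :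
    ∃ P : Q.Partition, P.1.2.1 = z ∧ infoSet P = S := by
  obtain ⟨hSU, hSn⟩ := Finset.mem_powersetCard.1 hS
  let s : BitString Q.N := fun j => if j ∈ S then 1 else 0
  have hs : (Finset.univ.filter fun j => s j ≠ 0) = S := by
    ext j
    simp [s]
  have hb : (Finset.univ.filter fun j => (1 + s + z) j ≠ 0) = nonZ z \ S := by
    ext j
    have h2 : (1 : Bit) + 1 = 0 := rfl
    have hj : j ∈ S → z j = 0 := fun h => by simpa [nonZ] using hSU h
    by_cases h : j ∈ S
    · simp [s, h, h2, hj h]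
    · rcases bit_cases (z j) with h0 | h0 <;> simp [s, h, nonZ, h0, h2]
  have hsum : s + z + (1 + s + z) = 1 := by
    rw [add_assoc 1 s z, add_comm 1, ← add_assoc, BitString.add_self, zero_add]
  refine ⟨⟨(s, z, 1 + s + z), ?_, hz, ?_, ?_⟩, rfl, hs⟩
  · rw [hammingNorm, hs, hSn]
  · rw [hammingNorm, hb, Finset.card_sdiff_of_subset hSU, hSn, card_nonZ hz]
    omega
  · change hammingNorm (s + z + (1 + s + z)) = _
    rw [hsum, hammingNorm]
    simp

theorem hammingNorm_info (P : Q.Partition) (c : BitString Q.N) : hammingNorm (info P c) =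
    (infoSet P ∩ (nonZ P.1.2.1).filter fun j => c j ≠ 0).card := by
  rw [info, hammingNorm_substring]
  congr 1
  ext j
  simp only [infoSet, nonZ, Finset.mem_filter, Finset.mem_univ, true_and, Finset.mem_inter]
  exact ⟨fun h => ⟨h.1, (eq_zero_of_info P h.1).1, h.2⟩, fun h => ⟨h.1, h.2.2⟩⟩

theorem hammingNorm_testX_add (P : Q.Partition) (c : BitString Q.N) :
    hammingNorm (testX P c) + hammingNorm (info P c) =
      ((nonZ P.1.2.1).filter fun j => c j ≠ 0).card := by
  rw [hammingNorm_info, testX, hammingNorm_substring,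
    ← Finset.card_sdiff_add_card_inter ((nonZ P.1.2.1).filter fun j => c j ≠ 0) (infoSet P),
    Finset.inter_comm]
  congr 2
  ext j
  simp only [infoSet, nonZ, Finset.mem_filter, Finset.mem_univ, true_and, Finset.mem_sdiff,
    not_not, basis_ne_zero_iff]
  tauto

/-- The error string `c` passes the test on the TEST-X bits, but has many errors on the INFO
bits. -/
def Undetected (P : Q.Partition) (c : BitString Q.N) : Prop :=
  (hammingNorm (testX P c) : ℝ) / Q.nx ≤ Q.pax ∧ minDist Q.rows ≤ 2 * hammingNorm (info P c)

/-- With `h ≥ (p + ε) n` INFO errors and `a ≤ p n_x` TEST-X errors, `h / n - (a + h) / (n + n_x) =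
(n_x h - n a) / (n (n + n_x)) ≥ ε n_x / (n + n_x)`. -/
theorem le_card_of_undetected {ε : ℝ} (hn : 0 < Q.n) (hnx : 0 < Q.nx)
    (hd : (Q.pax + ε) * (2 * Q.n) ≤ minDist Q.rows) (P : Q.Partition) (c : BitString Q.N)
    (h : Undetected P c) :
    (Q.n : ℝ) * (((nonZ P.1.2.1).filter fun j => c j ≠ 0).card / (nonZ P.1.2.1).card +
      ε * (Q.nx / (Q.n + Q.nx))) ≤
      (infoSet P ∩ (nonZ P.1.2.1).filter fun j => c j ≠ 0).card := by
  rw [← hammingNorm_testX_add, ← hammingNorm_info, card_nonZ P.2.2.1]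
  obtain ⟨h1, h2⟩ := h
  have h2' : (minDist Q.rows : ℝ) ≤ 2 * hammingNorm (info P c) := by exact_mod_cast h2
  have hn' : (0 : ℝ) < Q.n := by exact_mod_cast hn
  have hnx' : (0 : ℝ) < Q.nx := by exact_mod_cast hnx
  rw [div_le_iff₀ hnx'] at h1
  push_cast
  rw [← mul_div_assoc, ← add_div, ← mul_div_assoc, div_le_iff₀ (by positivity)]
  have h3 : (Q.pax + ε) * Q.n ≤ hammingNorm (info P c) := by linarith
  nlinarith [mul_le_mul_of_nonneg_left h1 hn'.le, mul_le_mul_of_nonneg_left h3 hnx'.le]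

open Classical in
theorem card_undetected_le {ε : ℝ} (hε : 0 ≤ ε) (hn : 0 < Q.n) (hnx : 0 < Q.nx)
    (hd : (Q.pax + ε) * (2 * Q.n) ≤ minDist Q.rows) (z c : BitString Q.N) :
    ((Finset.univ.filter fun P : Q.Partition => P.1.2.1 = z ∧ Undetected P c).card : ℝ) ≤
      Real.exp (-2 * Q.n * (ε * (Q.nx / (Q.n + Q.nx))) ^ 2) *
        (Finset.univ.filter fun P : Q.Partition => P.1.2.1 = z).card := by
  by_cases hz : hammingNorm z = Q.nz
  swap
  · rw [Finset.filter_eq_empty_iff.2, Finset.card_empty, Nat.cast_zero]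
    · positivity
    · rintro P - ⟨rfl, -⟩
      exact hz P.2.2.1
  have hcard : ((nonZ z).powersetCard Q.n).card ≤
      (Finset.univ.filter fun P : Q.Partition => P.1.2.1 = z).card := by
    refine Finset.card_le_card_of_surjOn infoSet fun S hS => ?_
    obtain ⟨P, h1, h2⟩ := exists_partition hz hS
    exact ⟨P, by simpa using h1, h2⟩
  have hle : (Finset.univ.filter fun P : Q.Partition => P.1.2.1 = z ∧ Undetected P c).card ≤
      (((nonZ z).powersetCard Q.n).filter fun S => (Q.n : ℝ) *
        (((nonZ z).filter fun j => c j ≠ 0).card / (nonZ z).card +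
          ε * (Q.nx / (Q.n + Q.nx))) ≤ (S ∩ (nonZ z).filter fun j => c j ≠ 0).card).card := by
    refine Finset.card_le_card_of_injOn infoSet ?_ ?_
    · intro P hP
      obtain ⟨rfl, hP2⟩ := (Finset.mem_filter.1 hP).2
      exact Finset.mem_filter.2 ⟨infoSet_mem P, le_card_of_undetected hn hnx hd P c hP2⟩
    · intro P hP P' hP' h
      exact partition_ext ((Finset.mem_filter.1 hP).2.1.trans (Finset.mem_filter.1 hP').2.1.symm) h
  refine (Nat.cast_le.2 hle).trans ((card_filter_powersetCard_le (Finset.filter_subset _ _) Q.n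
    (by positivity)).trans ?_)
  exact mul_le_mul_of_nonneg_left (Nat.cast_le.2 hcard) (Real.exp_pos _).le

open Classical in
/-- If the INFO bits are sent in the `x` basis, then the test rarely misses many errors. -/
theorem sum_undetected_le {ε : ℝ} (hε : 0 ≤ ε) (hn : 0 < Q.n) (hnx : 0 < Q.nx)
    (hd : (Q.pax + ε) * (2 * Q.n) ≤ minDist Q.rows) (A : CollectiveAttack Q.N) :
    ∑ P : Q.Partition, ∑ i, ∑ iB, (if Undetected P (i + iB) then
        A.outcomeProb (conjugateBases P) i iB else 0) ≤
      Real.exp (-2 * Q.n * (ε * (Q.nx / (Q.n + Q.nx))) ^ 2) *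
        (Fintype.card Q.Partition * 2 ^ Q.N) := by
  set η := Real.exp (-2 * Q.n * (ε * (Q.nx / (Q.n + Q.nx))) ^ 2)
  have hfiber : ∀ f : Q.Partition → ℝ, ∑ P, f P =
      ∑ z : BitString Q.N, ∑ P ∈ Finset.univ.filter (fun P : Q.Partition => P.1.2.1 = z), f P :=
    fun f => (Finset.sum_fiberwise _ _ _).symm
  have hleft : ∀ z : BitString Q.N,
      ∑ P ∈ Finset.univ.filter (fun P : Q.Partition => P.1.2.1 = z), ∑ i, ∑ iB,
        (if Undetected P (i + iB) then A.outcomeProb (conjugateBases P) i iB else 0) =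
      ∑ i, ∑ iB, (Finset.univ.filter fun P : Q.Partition =>
        P.1.2.1 = z ∧ Undetected P (i + iB)).card * A.outcomeProb (1 + z) i iB := by
    intro z
    rw [Finset.sum_comm]
    refine Finset.sum_congr rfl fun i _ => ?_
    rw [Finset.sum_comm]
    refine Finset.sum_congr rfl fun iB _ => ?_
    rw [← Finset.sum_filter, Finset.filter_filter, ← nsmul_eq_mul, ← Finset.sum_const]
    refine Finset.sum_congr rfl fun P hP => ?_
    -- The conjugate bases are a function of `z` alone, so the outcome probability is constant on
    -- the fibre and only the undetected partitions are counted.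
    rw [conjugateBases, (Finset.mem_filter.1 hP).2.1]
  have hone : ∀ b : BitString Q.N, ∑ i, ∑ iB, A.outcomeProb b i iB = 2 ^ Q.N := by
    intro b
    simp only [A.sum_outcomeProb, Finset.sum_const, Finset.card_univ, card_bitString]
    simp
  have hcardP : (Fintype.card Q.Partition : ℝ) = ∑ z : BitString Q.N,
      ((Finset.univ.filter fun P : Q.Partition => P.1.2.1 = z).card : ℝ) := by
    have := hfiber fun _ => 1
    simpa using this
  rw [hfiber, hcardP, Finset.sum_mul, Finset.mul_sum]
  refine Finset.sum_le_sum fun z _ => ?_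
  rw [hleft, ← hone (1 + z), ← mul_assoc, Finset.mul_sum]
  refine Finset.sum_le_sum fun i _ => ?_
  rw [Finset.mul_sum]
  exact Finset.sum_le_sum fun iB _ => mul_le_mul_of_nonneg_right
    (card_undetected_le hε hn hnx hd z _) (A.outcomeProb_nonneg _ _ _)

end Params

/-! ### The distance of the final state from the ideal state -/

section Trace

theorem kronecker_sum {ι α β : Type*} (s : Finset ι) (X : Matrix α α ℂ)
    (Y : ι → Matrix β β ℂ) : X ⊗ₖ (∑ i ∈ s, Y i) = ∑ i ∈ s, X ⊗ₖ Y i := by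
  ext a b
  simp [Matrix.sum_apply, Finset.mul_sum]

theorem sum_kronecker {ι α β : Type*} (s : Finset ι) (X : ι → Matrix α α ℂ)
    (Y : Matrix β β ℂ) : (∑ i ∈ s, X i) ⊗ₖ Y = ∑ i ∈ s, X i ⊗ₖ Y := by
  ext a b
  simp [Matrix.sum_apply, Finset.sum_mul]

theorem traceFst_sum {ι α β : Type*} [Fintype α] (s : Finset ι)
    (X : ι → Matrix (α × β) (α × β) ℂ) : traceFst (∑ i ∈ s, X i) = ∑ i ∈ s, traceFst (X i) := by
  ext a b
  simp only [traceFst, Matrix.of_apply, Matrix.sum_apply]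
  exact Finset.sum_comm

theorem traceFst_smul {α β : Type*} [Fintype α] (c : ℂ) (X : Matrix (α × β) (α × β) ℂ) :
    traceFst (c • X) = c • traceFst X := by
  ext a b
  simp [traceFst, Finset.mul_sum]

theorem traceFst_kronecker {α β : Type*} [Fintype α] (X : Matrix α α ℂ) (Y : Matrix β β ℂ) :
    traceFst (X ⊗ₖ Y) = X.trace • Y := by
  ext a b
  simp [traceFst, Matrix.trace, Finset.sum_mul]

theorem trace_proj {α : Type*} [Fintype α] (a : α) : (proj a).trace = 1 := by
  classical
  simp [proj, Matrix.trace]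

theorem isHermitian_proj {α : Type*} (a : α) : (proj a).IsHermitian := by
  classical
  simp [proj, Matrix.IsHermitian]

theorem isHermitian_kronecker {α β : Type*} {X : Matrix α α ℂ} {Y : Matrix β β ℂ}
    (hX : X.IsHermitian) (hY : Y.IsHermitian) : (X ⊗ₖ Y).IsHermitian := by
  rw [Matrix.IsHermitian, Matrix.conjTranspose_kronecker, hX, hY]

theorem isHermitian_traceFst {α β : Type*} [Fintype α] {X : Matrix (α × β) (α × β) ℂ}
    (hX : X.IsHermitian) : (traceFst X).IsHermitian := by
  ext a b
  simp only [traceFst, Matrix.conjTranspose_apply, Matrix.of_apply, star_sum]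
  exact Finset.sum_congr rfl fun c _ => hX.apply _ _

theorem isHermitian_sum {ι α : Type*} (s : Finset ι) {X : ι → Matrix α α ℂ}
    (h : ∀ i, (X i).IsHermitian) : (∑ i ∈ s, X i).IsHermitian := by
  rw [Matrix.IsHermitian, Matrix.conjTranspose_sum]
  exact Finset.sum_congr rfl fun i _ => h i

theorem isHermitian_smul {α : Type*} {c : ℂ} (hc : star c = c) {X : Matrix α α ℂ}
    (h : X.IsHermitian) : (c • X).IsHermitian := by
  rw [Matrix.IsHermitian, Matrix.conjTranspose_smul, hc, h]

/-- The block of an operator at a value of the classical registers. -/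
def block {κ ε π : Type*} (W : Matrix (κ × (ε × π)) (κ × (ε × π)) ℂ) (k : κ) (p : π) :
    Matrix ε ε ℂ := W.submatrix (fun e => (k, (e, p))) (fun e => (k, (e, p)))

theorem trace_kronecker_mul {κ₁ κ₂ ε π : Type*} [Fintype κ₁] [Fintype κ₂] [Fintype ε] [Fintype π]
    (k₁ : κ₁) (k₂ : κ₂) (p : π) (X : Matrix ε ε ℂ)
    (W : Matrix ((κ₁ × κ₂) × (ε × π)) ((κ₁ × κ₂) × (ε × π)) ℂ) :
    (((proj k₁ ⊗ₖ proj k₂) ⊗ₖ (X ⊗ₖ proj p)) * W).trace =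
      (X * block W (k₁, k₂) p).trace := by
  classical
  simp only [Matrix.trace, Matrix.diag_apply, Matrix.mul_apply, Fintype.sum_prod_type,
    Matrix.kroneckerMap_apply, proj, Matrix.single_apply, block, Matrix.submatrix_apply]
  rw [Finset.sum_eq_single k₁ (fun b _ hb => by simp [hb.symm]) (by simp),
    Finset.sum_eq_single k₂ (fun b _ hb => by simp [hb.symm]) (by simp)]
  refine Finset.sum_congr rfl fun e _ => ?_
  rw [Finset.sum_eq_single p (fun b _ hb => by simp [hb.symm]) (by simp),
    Finset.sum_eq_single k₁ (fun b _ hb => by simp [hb.symm]) (by simp),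
    Finset.sum_eq_single k₂ (fun b _ hb => by simp [hb.symm]) (by simp)]
  refine Finset.sum_congr rfl fun e' _ => ?_
  rw [Finset.sum_eq_single p (fun b _ hb => by simp [hb.symm]) (by simp)]
  simp

theorem trace_vecMulVec_mul {E : Type*} [Fintype E] (φ : E → ℂ) (K : Matrix E E ℂ) :
    (Matrix.vecMulVec φ (star φ) * K).trace = form K φ φ := by
  rw [Matrix.vecMulVec_mul, Matrix.trace_vecMulVec, form, Matrix.dotProduct_mulVec,
    dotProduct_comm]

/-- Extending vectors by zero to the larger space preserves norms and turns the form of the block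
into that of `W`. -/
theorem formBound_block {κ ε π : Type*} [Fintype κ] [Fintype ε] [Fintype π]
    {W : Matrix (κ × (ε × π)) (κ × (ε × π)) ℂ} {C : ℝ} (hW : FormBound C W) (k : κ) (p : π) :
    FormBound C (block W k p) := by
  classical
  intro φ ψ
  let ext : (ε → ℂ) → κ × (ε × π) → ℂ := fun φ a => if a.1 = k ∧ a.2.2 = p then φ a.2.1 else 0
  have hnorm : ∀ φ : ε → ℂ, ∑ a, ‖ext φ a‖ ^ 2 = ∑ e, ‖φ e‖ ^ 2 := by
    intro φ
    simp only [ext, Fintype.sum_prod_type]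
    rw [Finset.sum_eq_single k (fun b _ hb => by simp [hb]) (by simp)]
    refine Finset.sum_congr rfl fun e _ => ?_
    rw [Finset.sum_eq_single p (fun b _ hb => by simp [hb]) (by simp)]
    simp
  have hform : star (ext φ) ⬝ᵥ W.mulVec (ext ψ) = star φ ⬝ᵥ (block W k p).mulVec ψ := by
    simp only [ext, dotProduct, Matrix.mulVec, Fintype.sum_prod_type, Pi.star_apply, block,
      Matrix.submatrix_apply]
    rw [Finset.sum_eq_single k (fun b _ hb => by simp [hb]) (by simp)]
    refine Finset.sum_congr rfl fun e _ => ?_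
    rw [Finset.sum_eq_single p (fun b _ hb => by simp [hb]) (by simp),
      Finset.sum_eq_single k (fun b _ hb => by simp [hb]) (by simp)]
    simp only [and_self, if_true]
    congr 1
    refine Finset.sum_congr rfl fun e' _ => ?_
    rw [Finset.sum_eq_single p (fun b _ hb => by simp [hb]) (by simp)]
    simp
  have h := hW (ext φ) (ext ψ)
  rwa [hform, hnorm, hnorm] at h

end Trace

/-! ### The security estimate for the states of the protocol. -/

section Security

open Params

variable {Q : Params} (A : CollectiveAttack Q.N)

theorem isHermitian_finalStateWith
    (kB : Q.Partition → BitString Q.N → BitString Q.N → Q.Key) :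
    (finalStateWith A kB).IsHermitian := by
  refine isHermitian_sum _ fun i => isHermitian_sum _ fun iB => isHermitian_sum _ fun P => ?_
  split_ifs
  · refine isHermitian_smul (by simp) (isHermitian_kronecker
      (isHermitian_kronecker (isHermitian_proj _) (isHermitian_proj _))
      (isHermitian_kronecker ?_ (isHermitian_proj _)))
    refine isHermitian_smul (by simp) ?_
    rw [Matrix.IsHermitian, Matrix.conjTranspose_vecMulVec, star_star]
  · exact Matrix.isHermitian_zero

theorem isHermitian_difference : (rhoABEprime A - rhoU Q ⊗ₖ rhoE A).IsHermitian := by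
  refine Matrix.IsHermitian.sub (isHermitian_finalStateWith A _) (isHermitian_kronecker ?_
    (isHermitian_traceFst (isHermitian_finalStateWith A _)))
  exact isHermitian_smul (by simp) (isHermitian_sum _ fun k =>
    isHermitian_kronecker (isHermitian_proj _) (isHermitian_proj _))

/-- The probability of each choice of Alice's string and of the partition. -/
def choiceProb (Q : Params) : ℝ := 1 / (Fintype.card Q.Partition : ℝ) * (1 / 2 ^ Q.N)

theorem jointProb_smul_eveState (i iB : BitString Q.N) (P : Q.Partition) :
    (jointProb A i iB P : ℂ) • A.eveState (bases P) i iB =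
      (choiceProb Q : ℂ) • Matrix.vecMulVec (A.probeVector (bases P) i iB)
        (star (A.probeVector (bases P) i iB)) := by
  rw [← A.outcomeProb_smul_eveState, smul_smul, ← Complex.ofReal_mul]
  rfl

-- Key projectors have trace one, so Bob's error correction disappears from Eve's state.
open Classical in
theorem rhoE_eq : rhoE A = ∑ i, ∑ iB, ∑ P : Q.Partition, if TestPassed P i iB then
    (jointProb A i iB P : ℂ) • (A.eveState (bases P) i iB ⊗ₖ proj (published P i iB)) else 0 := by
  have hz : traceFst (0 : Matrix (ABE A) (ABE A) ℂ) = 0 := by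
    ext a b; simp [traceFst]
  simp only [rhoE, rhoABE, finalStateWith, traceFst_sum]
  refine Finset.sum_congr rfl fun i _ => Finset.sum_congr rfl fun iB _ =>
    Finset.sum_congr rfl fun P _ => ?_
  split_ifs
  · rw [traceFst_smul, traceFst_kronecker, Matrix.trace_kronecker, trace_proj, trace_proj,
      one_mul, one_smul]
  · exact hz

-- Both keys coincide in the real and in the ideal state, so only the blocks at `(k, k)` occur. The
-- ideal state contributes their average over `k`, and `sum_hybridDiff` telescopes the difference.
open Classical in
theorem trace_difference_mul (W : Matrix (ABE A) (ABE A) ℂ) :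
    ((rhoABEprime A - rhoU Q ⊗ₖ rhoE A) * W).trace =
      (choiceProb Q : ℂ) * ∑ P : Q.Partition, ∑ l : Fin Q.m, ∑ i, ∑ iB,
        if TestPassed P i iB then
          form (hybridDiff (fun k => block W (k, k) (published P i iB)) l (aliceKey P i))
            (A.probeVector (bases P) i iB) (A.probeVector (bases P) i iB)
        else 0 := by
  have hterm : ∀ i iB (P : Q.Partition) (k : Q.Key),
      ((((jointProb A i iB P : ℂ) • ((proj k ⊗ₖ proj k) ⊗ₖ
          (A.eveState (bases P) i iB ⊗ₖ proj (published P i iB)))) * W).trace) =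
        choiceProb Q * form (block W (k, k) (published P i iB))
          (A.probeVector (bases P) i iB) (A.probeVector (bases P) i iB) := by
    intro i iB P k
    rw [← Matrix.kronecker_smul, ← Matrix.smul_kronecker, jointProb_smul_eveState,
      trace_kronecker_mul, Matrix.smul_mul, Matrix.trace_smul, trace_vecMulVec_mul, smul_eq_mul]
  have hU : rhoU Q ⊗ₖ rhoE A = ∑ i, ∑ iB, ∑ P : Q.Partition, if TestPassed P i iB then
      ((2 : ℂ) ^ Q.m)⁻¹ • ∑ k : Q.Key, (jointProb A i iB P : ℂ) • ((proj k ⊗ₖ proj k) ⊗ₖ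
          (A.eveState (bases P) i iB ⊗ₖ proj (published P i iB))) else 0 := by
    simp only [rhoE_eq, kronecker_sum]
    refine Finset.sum_congr rfl fun i _ => Finset.sum_congr rfl fun iB _ =>
      Finset.sum_congr rfl fun P _ => ?_
    split_ifs
    · rw [rhoU, one_div, Matrix.smul_kronecker, sum_kronecker]
      simp only [Matrix.kronecker_smul]
    · simp
  rw [hU, rhoABEprime, finalStateWith]
  simp only [← Finset.sum_sub_distrib, Finset.sum_mul, Matrix.trace_sum]
  have hcomm : ∀ f : BitString Q.N → BitString Q.N → Q.Partition → ℂ,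
      ∑ i, ∑ iB, ∑ P, f i iB P = ∑ P, ∑ i, ∑ iB, f i iB P := by
    intro f
    refine Eq.trans ?_ Finset.sum_comm
    exact Finset.sum_congr rfl fun i _ => Finset.sum_comm
  rw [hcomm, Finset.mul_sum]
  refine Finset.sum_congr rfl fun P _ => ?_
  rw [Finset.sum_comm (s := (Finset.univ : Finset (Fin Q.m))), Finset.mul_sum]
  refine Finset.sum_congr rfl fun i _ => ?_
  rw [Finset.sum_comm (s := (Finset.univ : Finset (Fin Q.m))), Finset.mul_sum]
  refine Finset.sum_congr rfl fun iB _ => ?_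
  split_ifs
  · rw [← form_sum, sum_hybridDiff, Matrix.sub_mul, Matrix.trace_sub, hterm, Matrix.smul_mul,
      Matrix.trace_smul, Finset.sum_mul, Matrix.trace_sum, form_sub, form_smul, form_sum]
    simp only [hterm]
    rw [← Finset.mul_sum, smul_eq_mul]
    ring
  · simp

theorem info_split_symm (P : Q.Partition) (x : BitString Q.n)
    (τ : BitString Q.nz × BitString Q.nx) : info P ((split P).symm (x, τ)) = x :=
  congrArg Prod.fst ((split P).apply_symm_apply (x, τ))

theorem testZ_split_symm (P : Q.Partition) (x : BitString Q.n)
    (τ : BitString Q.nz × BitString Q.nx) : testZ P ((split P).symm (x, τ)) = τ.1 :=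
  congrArg (fun a => a.2.1) ((split P).apply_symm_apply (x, τ))

theorem testX_split_symm (P : Q.Partition) (x : BitString Q.n)
    (τ : BitString Q.nz × BitString Q.nx) : testX P ((split P).symm (x, τ)) = τ.2 :=
  congrArg (fun a => a.2.2) ((split P).apply_symm_apply (x, τ))

theorem sum_split {M : Type*} [AddCommMonoid M] (P : Q.Partition)
    (f : BitString Q.N → BitString Q.N → M) :
    ∑ i, ∑ iB, f i iB = ∑ t : (BitString Q.nz × BitString Q.nx) × (BitString Q.nz × BitString Q.nx),
      ∑ x, ∑ xB, f ((split P).symm (x, t.1)) ((split P).symm (xB, t.2)) := by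
  have h1 : ∀ g : BitString Q.N → M, ∑ i, g i = ∑ τ, ∑ x, g ((split P).symm (x, τ)) := fun g => by
    rw [← Equiv.sum_comp (split P).symm g, Fintype.sum_prod_type_right]
  have h2 : ∀ τ, ∑ x, ∑ iB, f ((split P).symm (x, τ)) iB =
      ∑ τB, ∑ x, ∑ xB, f ((split P).symm (x, τ)) ((split P).symm (xB, τB)) := fun τ => by
    simp only [h1 (f _)]
    exact Finset.sum_comm
  rw [h1]
  exact (Finset.sum_congr rfl fun τ _ => h2 τ).trans (Fintype.sum_prod_type' _).symm

-- For fixed test bits `t` of both parties, the verdict of the test is constant and the published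
-- data depend on `x` through the syndrome only, so `norm_sum_form_le` applies for each `t`.
-- Cauchy–Schwarz then recombines the values of `t`.
open Classical in
theorem norm_sum_form_partition_le (P : Q.Partition) (l : Fin Q.m)
    (g : Q.Public → Q.Key → Matrix A.Probes A.Probes ℂ) (hg : ∀ p k, FormBound 1 (g p k)) :
    ‖∑ i, ∑ iB, if TestPassed P i iB then
        form (hybridDiff (g (published P i iB)) l (aliceKey P i))
          (A.probeVector (bases P) i iB) (A.probeVector (bases P) i iB) else 0‖ ≤
      4 * (Real.sqrt (∑ i, ∑ iB, A.outcomeProb (conjugateBases P) i iB) *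
        Real.sqrt (∑ i, ∑ iB, if Undetected P (i + iB) then
          A.outcomeProb (conjugateBases P) i iB else 0)) := by
  rw [sum_split P, sum_split P, sum_split P]
  have hS := Real.sum_sqrt_mul_sqrt_le
    (Finset.univ : Finset ((BitString Q.nz × BitString Q.nx) × (BitString Q.nz × BitString Q.nx)))
    (f := fun t => ∑ x, ∑ xB, A.outcomeProb (conjugateBases P) ((split P).symm (x, t.1))
      ((split P).symm (xB, t.2)))
    (g := fun t => ∑ x, ∑ xB, if Undetected P ((split P).symm (x, t.1) + (split P).symm (xB, t.2))
      then A.outcomeProb (conjugateBases P) ((split P).symm (x, t.1))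
        ((split P).symm (xB, t.2)) else 0)
    (fun t => Finset.sum_nonneg fun x _ => Finset.sum_nonneg fun xB _ =>
      A.outcomeProb_nonneg _ _ _)
    (fun t => Finset.sum_nonneg fun x _ => Finset.sum_nonneg fun xB _ => by
      split_ifs
      · exact A.outcomeProb_nonneg _ _ _
      · exact le_rfl)
  refine (norm_sum_le _ _).trans (le_trans ?_ (mul_le_mul_of_nonneg_left hS (by norm_num)))
  rw [Finset.mul_sum]
  refine Finset.sum_le_sum fun t _ => ?_
  have hadd : ∀ i iB : BitString Q.N, testZ P (i + iB) = testZ P i + testZ P iB ∧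
      testX P (i + iB) = testX P i + testX P iB ∧ info P (i + iB) = info P i + info P iB :=
    fun _ _ => ⟨rfl, rfl, rfl⟩
  have hpass : ∀ x xB, TestPassed P ((split P).symm (x, t.1)) ((split P).symm (xB, t.2)) ↔
      (hammingNorm (t.1.1 + t.2.1) : ℝ) / Q.nz ≤ Q.paz ∧
      (hammingNorm (t.1.2 + t.2.2) : ℝ) / Q.nx ≤ Q.pax := by
    intro x xB
    rw [TestPassed, (hadd _ _).1, (hadd _ _).2.1]
    simp only [testZ_split_symm, testX_split_symm]
  by_cases hT : (hammingNorm (t.1.1 + t.2.1) : ℝ) / Q.nz ≤ Q.paz ∧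
      (hammingNorm (t.1.2 + t.2.2) : ℝ) / Q.nx ≤ Q.pax
  swap
  · simp only [hpass, if_neg hT, Finset.sum_const_zero, norm_zero]
    positivity
  have hpub : ∀ x xB, published P ((split P).symm (x, t.1)) ((split P).symm (xB, t.2)) =
      (t.1.1, t.1.2, t.2.1, t.2.2, P, Q.syndrome x) := by
    intro x xB
    simp only [published, testZ_split_symm, testX_split_symm, info_split_symm]
  simp only [hpass, if_pos hT, hpub, aliceKey, info_split_symm, probeVector_eq_fourier,
    form_smul_left, form_smul_right, ← Finset.mul_sum]
  rw [norm_mul, norm_mul, norm_star, norm_inv, norm_pow, Complex.norm_ofNat]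
  have hcore := norm_sum_form_le (Q.precedingSpan l) (Q.rows (Fin.natAdd Q.r l))
    (fun x => hybridDiff (g (t.1.1, t.1.2, t.2.1, t.2.2, P, Q.syndrome x)) l (Q.key x))
    (C := 2) (by norm_num) (fun x => formBound_hybridDiff (hg _) _ _)
    (hybridDiff_key_add Q (fun ξ => g (t.1.1, t.1.2, t.2.1, t.2.2, P, ξ)) l)
    (fun s s' => A.probeVector (conjugateBases P) ((split P).symm (s, t.1))
      ((split P).symm (s', t.2)))
  simp only [A.normSq_probeVector] at hcore
  -- As `t` passes the test and `minDist` is at most the distance for row `l`, every bad pair `(s,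
  -- s')` is an undetected error string.
  have hmono : ∑ s, ∑ s', (if distToSubspace (Q.rows (Fin.natAdd Q.r l)) (Q.precedingSpan l) ≤
        2 * hammingNorm (s + s') then A.outcomeProb (conjugateBases P) ((split P).symm (s, t.1))
          ((split P).symm (s', t.2)) else 0) ≤
      ∑ x, ∑ xB, if Undetected P ((split P).symm (x, t.1) + (split P).symm (xB, t.2))
        then A.outcomeProb (conjugateBases P) ((split P).symm (x, t.1))
          ((split P).symm (xB, t.2)) else 0 := by
    refine Finset.sum_le_sum fun s _ => Finset.sum_le_sum fun s' _ => ?_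
    have hp := A.outcomeProb_nonneg (conjugateBases P) ((split P).symm (s, t.1))
          ((split P).symm (s', t.2))
    by_cases hd : distToSubspace (Q.rows (Fin.natAdd Q.r l)) (Q.precedingSpan l) ≤
        2 * hammingNorm (s + s')
    · rw [if_pos hd, if_pos]
      refine ⟨?_, ?_⟩
      · rw [(hadd _ _).2.1]
        simpa only [testX_split_symm] using hT.2
      · rw [(hadd _ _).2.2]
        simpa only [info_split_symm] using (Q.minDist_le l).trans hd
    · rw [if_neg hd]
      split_ifs
      · exact hp
      · exact le_rfl
  have harith : ∀ X : ℝ, ((2 : ℝ) ^ Q.n)⁻¹ * (((2 : ℝ) ^ Q.n)⁻¹ * (2 * 2 * (4 ^ Q.n * X))) =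
      4 * X := by
    intro X
    rw [show (4 : ℝ) ^ Q.n = 2 ^ Q.n * 2 ^ Q.n by rw [← mul_pow]; norm_num]
    have h1 : ((2 : ℝ) ^ Q.n)⁻¹ * 2 ^ Q.n = 1 := inv_mul_cancel₀ (by positivity)
    linear_combination (4 * X * (((2 : ℝ) ^ Q.n)⁻¹ * 2 ^ Q.n + 1)) * h1
  refine (mul_le_mul_of_nonneg_left (mul_le_mul_of_nonneg_left hcore (by positivity))
    (by positivity)).trans ?_
  rw [harith]
  exact mul_le_mul_of_nonneg_left (mul_le_mul_of_nonneg_left (Real.sqrt_le_sqrt hmono)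
    (Real.sqrt_nonneg _)) (by norm_num)

/-- Cauchy–Schwarz over the partitions turns the per-partition bounds into the square root of the
average probability of `Undetected`, controlled by `sum_undetected_le`. -/
theorem traceNorm_difference_le {ε : ℝ} (hε : 0 ≤ ε) (hn : 0 < Q.n) (hnx : 0 < Q.nx)
    (hd : (Q.pax + ε) * (2 * Q.n) ≤ minDist Q.rows) :
    traceNorm (rhoABEprime A - rhoU Q ⊗ₖ rhoE A) ≤
      4 * Q.m * Real.exp (-((Q.nx : ℝ) / (Q.n + Q.nx)) ^ 2 * Q.n * ε ^ 2) := by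
  classical
  obtain ⟨W, hW, hWM⟩ := exists_traceNorm_eq (isHermitian_difference A)
  rw [hWM, trace_difference_mul]
  refine (Complex.re_le_norm _).trans ?_
  have hc0 : 0 ≤ choiceProb Q := by unfold choiceProb; positivity
  have hone : ∀ b : BitString Q.N, ∑ i, ∑ iB, A.outcomeProb b i iB = 2 ^ Q.N := by
    intro b
    simp only [A.sum_outcomeProb, Finset.sum_const, Finset.card_univ, card_bitString]
    simp
  set B : Q.Partition → ℝ := fun P => ∑ i, ∑ iB, if Undetected P (i + iB) then
    A.outcomeProb (conjugateBases P) i iB else 0 with hB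
  have hB0 : ∀ P, 0 ≤ B P := fun P => Finset.sum_nonneg fun i _ => Finset.sum_nonneg fun iB _ => by
    split_ifs
    · exact A.outcomeProb_nonneg _ _ _
    · exact le_rfl
  have hsum := sum_undetected_le hε hn hnx hd A
  set η := Real.exp (-2 * Q.n * (ε * (Q.nx / (Q.n + Q.nx))) ^ 2) with hη
  have hηsqrt : Real.sqrt η = Real.exp (-((Q.nx : ℝ) / (Q.n + Q.nx)) ^ 2 * Q.n * ε ^ 2) := by
    rw [hη, Real.sqrt_eq_rpow, ← Real.exp_mul]
    ring_nf
  set Z : ℝ := Fintype.card Q.Partition * 2 ^ Q.N with hZ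
  have hZ0 : 0 ≤ Z := by positivity
  -- An inequality suffices, and it avoids showing that partitions exist: with none, the left side
  -- is `0`.
  have hcZ : choiceProb Q * Z ≤ 1 := by
    have h2 : (2 : ℝ) ^ Q.N ≠ 0 := by positivity
    rw [choiceProb, hZ]
    by_cases h : (Fintype.card Q.Partition : ℝ) = 0
    · simp [h]
    · field_simp
      exact le_rfl
  rw [norm_mul, Complex.norm_real, Real.norm_of_nonneg hc0]
  have hP : ∀ P : Q.Partition, ‖∑ l : Fin Q.m, ∑ i, ∑ iB, if TestPassed P i iB then
          form (hybridDiff (fun k => block W (k, k) (published P i iB)) l (aliceKey P i))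
            (A.probeVector (bases P) i iB) (A.probeVector (bases P) i iB)
        else 0‖ ≤ Q.m * (4 * (Real.sqrt (2 ^ Q.N) * Real.sqrt (B P))) := by
    intro P
    refine (norm_sum_le _ _).trans ((Finset.sum_le_sum fun l _ =>
      norm_sum_form_partition_le A P l (fun p k => block W (k, k) p)
        fun p k => formBound_block hW _ _).trans (le_of_eq ?_))
    rw [Finset.sum_const, Finset.card_univ, Fintype.card_fin, nsmul_eq_mul, hone]
  have hCS := Real.sum_sqrt_mul_sqrt_le (Finset.univ : Finset Q.Partition)
    (f := fun _ => (2 : ℝ) ^ Q.N) (g := B) (fun _ => by positivity) hB0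
  have hZ' : ∑ _P : Q.Partition, (2 : ℝ) ^ Q.N = Z := by simp [hZ]
  rw [hZ'] at hCS
  have hZη : Real.sqrt Z * Real.sqrt (∑ P, B P) ≤ Z * Real.sqrt η := by
    calc Real.sqrt Z * Real.sqrt (∑ P, B P) ≤ Real.sqrt Z * Real.sqrt (η * Z) := by gcongr
      _ = Z * Real.sqrt η := by
        rw [Real.sqrt_mul (Real.exp_pos _).le, mul_left_comm, Real.mul_self_sqrt hZ0, mul_comm]
  calc _ ≤ choiceProb Q * ∑ P, (Q.m * (4 * (Real.sqrt (2 ^ Q.N) * Real.sqrt (B P)))) :=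
        mul_le_mul_of_nonneg_left ((norm_sum_le _ _).trans (Finset.sum_le_sum fun P _ => hP P)) hc0
    _ = choiceProb Q * (Q.m * (4 * ∑ P, (Real.sqrt (2 ^ Q.N) * Real.sqrt (B P)))) := by
        rw [← Finset.mul_sum, ← Finset.mul_sum]
    _ ≤ choiceProb Q * (Q.m * (4 * (Z * Real.sqrt η))) := by
        gcongr
        exact hCS.trans hZη
    _ = (choiceProb Q * Z) * (4 * Q.m * Real.sqrt η) := by ring
    _ ≤ 1 * (4 * Q.m * Real.sqrt η) := by gcongr
    _ = _ := by rw [one_mul, hηsqrt]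

end Security

end BB84InfoZ

end

theorem mainTheorem5 (Q : BB84InfoZ.Params) (δ R ε : ℝ)
    (hδ : 0 < δ) (hR : 0 < R) (hε : 0 < ε)
    (hn : 0 < Q.n) (hnz : 0 < Q.nz) (hnx : 0 < Q.nx)
    (hpaz : 0 < Q.paz) (hpax : 0 < Q.pax)
    (hindep : LinearIndependent BB84InfoZ.Bit Q.rows)
    (hdist : δ < (BB84InfoZ.minDist Q.rows : ℝ) / Q.n)
    (hrate : (Q.m : ℝ) / Q.n ≤ R)
    (hthreshold : Q.pax + ε ≤ δ / 2)
    (A : BB84InfoZ.CollectiveAttack Q.N) :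
    1 / 2 * BB84InfoZ.traceNorm
        (BB84InfoZ.rhoABEprime A - BB84InfoZ.rhoU Q ⊗ₖ BB84InfoZ.rhoE A)
      ≤ 2 * R * Q.n *
        Real.exp (-((Q.nx : ℝ) / (Q.n + Q.nx)) ^ 2 * Q.n * ε ^ 2) := by
  have hn' : (0 : ℝ) < Q.n := by exact_mod_cast hn
  rw [lt_div_iff₀ hn'] at hdist
  rw [div_le_iff₀ hn'] at hrate
  -- `2 (p_{a,x} + ε) ≤ δ` and `δ n < d_{r,m}`: half the minimum distance exceeds the tolerated INFO
  -- error count.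
  have hd : (Q.pax + ε) * (2 * Q.n) ≤ BB84InfoZ.minDist Q.rows := by nlinarith
  have h := BB84InfoZ.traceNorm_difference_le A hε.le hn hnx hd
  have hexp := Real.exp_pos (-((Q.nx : ℝ) / (Q.n + Q.nx)) ^ 2 * Q.n * ε ^ 2)
  have h2 := mul_le_mul_of_nonneg_right hrate hexp.le
  linarith
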